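/- **Theorem 2 (Security in the Dishonest Model).** For $n\ge 1$ and a bit string $y$ let $\Delta(y)=\sum_i y_i$, and let $$|\Phi_0^n\rangle=\frac{1}{\sqrt{2^{n-1}}}\Big[\sum_{\Delta(y)\equiv 0\ (\mathrm{mod}\ 4)}|y\rangle-\sum_{\Delta(y)\equiv 2\ (\mathrm{mod}\ 4)}|y\rangle\Big],$$ the sums being over $y\in\{0,1\}^n$; this state is locally equivalent to the $n$-party GHZ state. Let $n$ parties consist of a set $H$ of $k\ge 1$ honest parties, one of which is the Verifier, and of $n-k\ge 0$ colluding dishonest parties, who control the source. Each party holds one qubit, and the dishonest parties hold in addition an auxiliary system with a finite-dimensional Hilbert space $\mathcal A\neq 0$ (possibly $\mathcal A=\mathbb C$, that is, no auxiliary system). Let the unit vector $|\Psi\rangle\in(\mathbb C^2)^{\otimes n}\otimes\mathcal A$ be the joint state. The test $T$ is as follows. The Verifier picks $X\in\{0,1\}^n$ uniformly at random among the strings with $\sum_i X_i$ even, and sends $X_i$ privately to party $i$. Each honest party $i$ applies to its qubit $Z$ if $X_i=0$ and the Hadamard gate if $X_i=1$, measures it in the computational basis, and sends the outcome $Y_i$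 privately to the Verifier. The dishonest parties, knowing only the inputs $(X_i)_{i\notin H}$, perform an arbitrary joint measurement (POVM, depending on these inputs) on their qubits and the auxiliary system, and announce its outcome $(Y_i)_{i\notin H}\in\{0,1\}^{n-k}$. The Verifier accepts if and only if $\sum_i Y_i\equiv\frac12\sum_i X_i\pmod 2$. Fix any unit vector $|\alpha\rangle\in\mathcal A$, and let $D$ denote the trace distance between pure states, $D(|\psi\rangle,|\phi\rangle)=\frac12\big\||\psi\rangle\langle\psi|-|\phi\rangle\langle\phi|\big\|_1$. Then the minimum $$\epsilon=\min_U D\big((I\otimes U)|\Psi\rangle,\ |\Phi_0^n\rangle\otimes|\alpha\rangle\big)$$ over all unitaries $U$ on the space $(\mathbb C^2)^{\otimes(n-k)}\otimes\mathcal A$ of the dishonest parties exists, and for every strategy of the dishonest parties $$\Pr[T(|\Psi\rangle)]\le 1-\frac{\epsilon^2}{4}.$$ -/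

import Mathlib

open scoped Kronecker Matrix ComplexOrder

/-- A string with one bit for each element of `ι`; these strings label the computational basis of
a register of qubits indexed by `ι`. -/
abbrev BitString (ι : Type*) : Type _ := ι → Fin 2

/-- The Hamming weight of a bit string (also the integer sum of its bits). -/
def hammingWeight {ι : Type*} [Fintype ι] (y : BitString ι) : ℕ := ∑ i, (y i : ℕ)

/-- The `n`-qubit state (`1 ≤ n`)
`2^{-(n-1)/2} (∑_{Δ(y) ≡ 0 mod 4} |y⟩ - ∑_{Δ(y) ≡ 2 mod 4} |y⟩)`,
which is locally equivalent to the GHZ state. -/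
noncomputable def ghzState (n : ℕ) : EuclideanSpace ℂ (BitString (Fin n)) :=
  WithLp.toLp 2 fun y =>
    ((√((2 : ℝ) ^ (n - 1)))⁻¹ : ℂ) *
      (if hammingWeight y % 4 = 0 then 1 else if hammingWeight y % 4 = 2 then -1 else 0)

/-- The action of a matrix on a vector. -/
noncomputable def applyOp {m : Type*} [Fintype m] (M : Matrix m m ℂ) (ψ : EuclideanSpace ℂ m) :
    EuclideanSpace ℂ m :=
  WithLp.toLp 2 (M *ᵥ ψ.ofLp)

/-- The rank-one operator `|ψ⟩⟨ψ|`. -/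
noncomputable def ketbra {m : Type*} (ψ : EuclideanSpace ℂ m) : Matrix m m ℂ :=
  Matrix.vecMulVec ψ.ofLp (star ψ.ofLp)

/-- The trace norm: the sum of the singular values, i.e. of the square roots of the eigenvalues of
`Mᴴ * M`. -/
noncomputable def traceNorm {m : Type*} [Fintype m] [DecidableEq m] (M : Matrix m m ℂ) : ℝ :=
  ∑ i, √((Matrix.isHermitian_conjTranspose_mul_self M).eigenvalues i)

/-- The trace distance between the pure states `ψ` and `φ`. -/
noncomputable def traceDist {m : Type*} [Fintype m] [DecidableEq m]
    (ψ φ : EuclideanSpace ℂ m) : ℝ :=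
  traceNorm (ketbra ψ - ketbra φ) / 2

/-- A measurement (POVM) with outcomes in `Y` on a system with orthonormal basis labelled by `m`. -/
structure POVM (Y m : Type*) [Fintype Y] [Fintype m] [DecidableEq m] where
  /-- the effect of each outcome -/
  effect : Y → Matrix m m ℂ
  posSemidef : ∀ y, (effect y).PosSemidef
  sum_effect : ∑ y, effect y = 1

section Protocol

variable {n : ℕ} (H : Finset (Fin n)) (A : Type*)

/-- Basis labels of the qubits of the honest parties. -/
abbrev HonestLabel : Type := BitString {i : Fin n // i ∈ H}

/-- Bit strings indexed by the dishonest parties. -/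
abbrev DishonestBits : Type := BitString {i : Fin n // i ∉ H}

/-- Basis labels of the joint system of the dishonest parties: one qubit for each of them, and an
auxiliary system. -/
abbrev DishonestLabel : Type _ := DishonestBits H × A

/-- Vectors of the joint system of the honest and the dishonest parties. -/
abbrev JointSpace : Type _ := EuclideanSpace ℂ (HonestLabel H × DishonestLabel H A)

/-- The inputs or outputs of the honest parties. -/
def honestPart (x : BitString (Fin n)) : HonestLabel H := fun i => x i

/-- The inputs or outputs of the dishonest parties. -/
def dishonestPart (x : BitString (Fin n)) : DishonestBits H := fun i => x i

/-- The bit string of all parties made of the bits of the honest and of the dishonest ones. -/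
def joinBits (h : HonestLabel H) (d : DishonestBits H) : BitString (Fin n) :=
  fun i => if hi : i ∈ H then h ⟨i, hi⟩ else d ⟨i, hi⟩

variable {A}

/-- The ideal `n`-qubit state of the parties together with the state `α` of the auxiliary system. -/
noncomputable def idealState (α : EuclideanSpace ℂ A) : JointSpace H A :=
  WithLp.toLp 2 fun b => ghzState n (joinBits H b.1 b.2.1) * α b.2.2

/-- The gate of a party before its measurement: `Z` on input `0`, Hadamard on input `1`. -/
noncomputable def inputGate (x : Fin 2) : Matrix (Fin 2) (Fin 2) ℂ :=
  if x = 0 then !![1, 0; 0, -1] else ((√2)⁻¹ : ℂ) • !![1, 1; 1, -1]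

/-- The tensor product of the gates of the honest parties. -/
noncomputable def honestGates (x : HonestLabel H) : Matrix (HonestLabel H) (HonestLabel H) ℂ :=
  Matrix.of fun y z => ∏ i, inputGate (x i) (y i) (z i)

/-- A joint strategy of the dishonest parties: they measure their joint system (including the
auxiliary one) by a POVM that may depend on all the inputs they received; its outcome is the string
of bits that they announce. -/
abbrev Strategy (H : Finset (Fin n)) (A : Type*) [Fintype A] [DecidableEq A] : Type _ :=
  DishonestBits H → POVM (DishonestBits H) (DishonestLabel H A)

/-- The input strings that the Verifier may choose: those of even sum. -/
def validInputs (n : ℕ) : Finset (BitString (Fin n)) :=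
  Finset.univ.filter fun x => hammingWeight x % 2 = 0

/-- The Verifier accepts outputs `y` for inputs `x` when `∑ yᵢ ≡ (∑ xᵢ) / 2 (mod 2)`. -/
def acceptedOutputs (x : BitString (Fin n)) : Finset (BitString (Fin n)) :=
  Finset.univ.filter fun y => hammingWeight y ≡ hammingWeight x / 2 [MOD 2]

variable [Fintype A] [DecidableEq A]

/-- The state after the honest parties applied the gates for the inputs `x`. -/
noncomputable def rotatedState (Ψ : JointSpace H A) (x : BitString (Fin n)) : JointSpace H A :=
  applyOp (honestGates H (honestPart H x) ⊗ₖ (1 : Matrix (DishonestLabel H A) (DishonestLabel H A) ℂ))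
    Ψ

/-- The probability that the outputs are `y` when the inputs are `x`: the honest parties measure
in the computational basis, the dishonest ones use their strategy. -/
noncomputable def outcomeProb (Ψ : JointSpace H A) (S : Strategy H A) (x y : BitString (Fin n)) :
    ℝ :=
  (inner ℂ (rotatedState H Ψ x)
    (applyOp (Matrix.single (honestPart H y) (honestPart H y) (1 : ℂ) ⊗ₖ
      (S (dishonestPart H x)).effect (dishonestPart H y)) (rotatedState H Ψ x))).re

/-- The probability that the Verifier accepts, the inputs being uniformly random among the valid
ones. -/
noncomputable def acceptProb (Ψ : JointSpace H A) (S : Strategy H A) : ℝ :=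
  (∑ x ∈ validInputs n, ∑ y ∈ acceptedOutputs x, outcomeProb H Ψ S x y) / (validInputs n).card

/-- The operator `U` of the dishonest parties applied to the joint state. -/
noncomputable def applyDishonest
    (U : Matrix (DishonestLabel H A) (DishonestLabel H A) ℂ) (Ψ : JointSpace H A) :
    JointSpace H A :=
  applyOp ((1 : Matrix (HonestLabel H) (HonestLabel H) ℂ) ⊗ₖ U) Ψ

end Protocol

/-! Let `a` and `c` be what the dishonest parties hold after the honest qubits are projected onto `v
= 2^(-k/2) ∑ I^Δ(h) |h⟩` and onto its complex conjugate `v̄`. Since `v ⊥ v̄`, `‖a‖² + ‖c‖² ≤ 1`.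
Both the acceptance probability and the overlap with the ideal state depend on `Ψ` only through `a`
and `c`.

Acceptance: an honest party measures `Z` or `X`, and `Z + I X` is the rank-one matrix with entries
`I^(z+z')`. The real part of `I^Δ(x)` is the sign in the acceptance rule for even `Δ(x)` and
vanishes for odd. Hence (`acceptProb_eq_add`) the probability is `1/2` plus the mean over dishonest
inputs `d` of `Re (I^Δ(d) ⟨a, B_d c⟩)`, where the parity observable `B_d` is a Hermitian
contraction. With `N = ‖a‖ ‖c‖`, such a `B` satisfies `(Re ⟨a, B c⟩)² + (Im ⟨a, c⟩)² ≤ N²`, and the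
same with `Re` and `Im` exchanged. If somebody is dishonest, half of the `d` are even and half odd,
so both bounds enter equally (`sum_re_phase_mul_inner_le`).

Overlap: the ideal state is `(v ⊗ f + v̄ ⊗ f') / √2` with `f ⊥ f'` unit vectors, so its squared
overlap with `U Ψ` is `|⟨f, U a⟩ + ⟨f', U c⟩|² / 2`. A suitable `U` attains `(‖a‖² + ‖c‖² + 2 √(N² -
|⟨a, c⟩|²)) / 2` (`exists_orthonormal_pair_inner_add_inner`), which bounds `ε²` from above. The
theorem is then the real inequality `sqrt_add_sqrt_le`. If everybody is honest, `f = f'` and every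
`B_d` is the identity, and a direct computation suffices. -/

/-! ### Trace distance of pure states in terms of their overlap. -/

section TraceDistance

variable {m : Type*} [Fintype m]

theorem inner_eq_star_dotProduct (ψ φ : EuclideanSpace ℂ m) :
    inner ℂ ψ φ = star ψ.ofLp ⬝ᵥ φ.ofLp := by
  rw [EuclideanSpace.inner_eq_star_dotProduct, dotProduct_comm]

theorem star_dotProduct_self_of_norm_eq_one {ψ : EuclideanSpace ℂ m} (hψ : ‖ψ‖ = 1) :
    star ψ.ofLp ⬝ᵥ ψ.ofLp = 1 := by
  rw [← inner_eq_star_dotProduct, inner_self_eq_norm_sq_to_K, hψ]; simp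

theorem ketbra_mul_ketbra (ψ φ : EuclideanSpace ℂ m) :
    ketbra ψ * ketbra φ = (inner ℂ ψ φ : ℂ) • Matrix.vecMulVec ψ.ofLp (star φ.ofLp) := by
  rw [inner_eq_star_dotProduct, ketbra, ketbra, Matrix.vecMulVec_mul_vecMulVec,
    Matrix.vecMulVec_smul]

/-- The difference `M` of two rank-one projections satisfies `M³ = d M` and `tr M² = 2 d`, with `d`
one minus the squared overlap. So the eigenvalues of `M²` are `0` or `d` and sum to `2 d`, and their
square roots sum to `2 √d`. -/
theorem traceDist_eq_sqrt [DecidableEq m] {ψ φ : EuclideanSpace ℂ m} (hψ : ‖ψ‖ = 1) (hφ : ‖φ‖ = 1) :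
    traceDist ψ φ = √(1 - ‖(inner ℂ φ ψ : ℂ)‖ ^ 2) := by
  set M := ketbra ψ - ketbra φ with hM
  set d : ℝ := 1 - ‖(inner ℂ φ ψ : ℂ)‖ ^ 2 with hd
  have hP : ketbra ψ * ketbra ψ = ketbra ψ := by
    rw [ketbra_mul_ketbra, inner_self_eq_norm_sq_to_K, hψ]; simp [ketbra]
  have hQ : ketbra φ * ketbra φ = ketbra φ := by
    rw [ketbra_mul_ketbra, inner_self_eq_norm_sq_to_K, hφ]; simp [ketbra]
  have hz : (inner ℂ ψ φ : ℂ) * inner ℂ φ ψ = ((1 - d : ℝ) : ℂ) := by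
    rw [← inner_conj_symm ψ φ, Complex.conj_mul', hd]; push_cast; ring
  have hPQP : ketbra ψ * ketbra φ * ketbra ψ = ((1 - d : ℝ) : ℂ) • ketbra ψ := by
    rw [ketbra_mul_ketbra, Matrix.smul_mul, ketbra, Matrix.vecMulVec_mul_vecMulVec,
      ← inner_eq_star_dotProduct, Matrix.vecMulVec_smul, smul_smul, hz]
  have hQPQ : ketbra φ * ketbra ψ * ketbra φ = ((1 - d : ℝ) : ℂ) • ketbra φ := by
    rw [ketbra_mul_ketbra, Matrix.smul_mul, ketbra, Matrix.vecMulVec_mul_vecMulVec,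
      ← inner_eq_star_dotProduct, Matrix.vecMulVec_smul, smul_smul, mul_comm, hz]
  have hMH : Mᴴ = M := by
    simp [hM, ketbra, Matrix.conjTranspose_vecMulVec]
  have hcube : M * M * M = (d : ℂ) • M := by
    have : M * M * M = ketbra ψ * ketbra ψ * ketbra ψ - ketbra ψ * ketbra ψ * ketbra φ
        - ketbra ψ * ketbra φ * ketbra ψ + ketbra ψ * (ketbra φ * ketbra φ)
        - ketbra φ * (ketbra ψ * ketbra ψ) + ketbra φ * ketbra ψ * ketbra φ
        + ketbra φ * ketbra φ * ketbra ψ - ketbra φ * ketbra φ * ketbra φ := by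
      rw [hM]; noncomm_ring
    rw [this, hPQP, hQPQ, hP, hQ, hP, hQ, hM]
    push_cast
    module
  have htr : (M * M).trace = ((2 * d : ℝ) : ℂ) := by
    have : M * M = ketbra ψ * ketbra ψ - ketbra ψ * ketbra φ - ketbra φ * ketbra ψ
      + ketbra φ * ketbra φ := by rw [hM]; noncomm_ring
    rw [this, hP, hQ, Matrix.trace_add, Matrix.trace_sub, Matrix.trace_sub,
      Matrix.trace_mul_comm (ketbra φ), ketbra_mul_ketbra, Matrix.trace_smul]
    simp only [ketbra, Matrix.trace_vecMulVec]
    rw [dotProduct_comm ψ.ofLp (star ψ.ofLp), dotProduct_comm φ.ofLp (star φ.ofLp),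
      dotProduct_comm ψ.ofLp (star φ.ofLp),
      star_dotProduct_self_of_norm_eq_one hψ, star_dotProduct_self_of_norm_eq_one hφ,
      ← inner_eq_star_dotProduct, smul_eq_mul, hz]
    push_cast; ring
  have hK := Matrix.isHermitian_conjTranspose_mul_self M
  have hsum : ∑ i, hK.eigenvalues i = 2 * d := by
    have h1 : (Mᴴ * M).trace = ((2 * d : ℝ) : ℂ) := by rw [hMH, htr]
    apply Complex.ofReal_injective
    rw [← h1, hK.trace_eq_sum_eigenvalues]; push_cast; rfl
  have hev : ∀ i, hK.eigenvalues i * hK.eigenvalues i = d * hK.eigenvalues i := by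
    intro i
    have h1 := hK.mulVec_eigenvectorBasis i
    have hne : (hK.eigenvectorBasis i).ofLp ≠ 0 := by
      intro h
      have h0 := hK.eigenvectorBasis.orthonormal.ne_zero i
      exact h0 (by ext j; simpa using congrFun h j)
    have h2 : (Mᴴ * M) * (Mᴴ * M) = (d : ℂ) • (Mᴴ * M) := by
      rw [hMH, ← mul_assoc, hcube, Matrix.smul_mul]
    have h3 := congrArg (fun X => X *ᵥ (hK.eigenvectorBasis i).ofLp) h2
    simp only at h3
    rw [← Matrix.mulVec_mulVec, Matrix.smul_mulVec, h1, Matrix.mulVec_smul, h1, smul_smul] at h3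
    rw [show ((d : ℂ) • hK.eigenvalues i • (hK.eigenvectorBasis i).ofLp)
      = (d * hK.eigenvalues i) • (hK.eigenvectorBasis i).ofLp by
        ext j; simp [mul_assoc]] at h3
    exact smul_left_injective ℝ hne h3
  have hd0 : 0 ≤ d := by
    have := norm_inner_le_norm (𝕜 := ℂ) φ ψ
    rw [hψ, hφ] at this
    have h0 := norm_nonneg (inner ℂ φ ψ : ℂ)
    rw [hd]; nlinarith
  have hsq : ∀ i, √(hK.eigenvalues i) * √d = hK.eigenvalues i := by
    intro i
    by_cases h : hK.eigenvalues i = 0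
    · simp [h]
    · rw [mul_right_cancel₀ h (hev i), Real.mul_self_sqrt hd0]
  have hfin : traceNorm M * √d = 2 * √d * √d := by
    rw [traceNorm, Finset.sum_mul, mul_assoc, Real.mul_self_sqrt hd0, ← hsum]
    exact Finset.sum_congr rfl fun i _ => hsq i
  have : traceNorm M = 2 * √d := by
    rcases hd0.eq_or_lt with h | h
    · rw [traceNorm, ← h, Real.sqrt_zero, mul_zero]
      refine Finset.sum_eq_zero fun i _ => ?_
      have := hev i
      rw [← h, zero_mul, mul_self_eq_zero] at this
      rw [this, Real.sqrt_zero]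
    · exact mul_right_cancel₀ (Real.sqrt_pos.2 h).ne' hfin
  rw [traceDist, this]; ring

end TraceDistance

/-! ### Real and imaginary parts of matrix elements of Hermitian contractions. -/

section Contraction

variable {E : Type*} [NormedAddCommGroup E] [InnerProductSpace ℂ E]

/-- The cross term is purely imaginary because `⟨B c, c⟩` is real; this is the only use of symmetry.
-/
theorem norm_smul_add_I_smul_sq {B : E →ₗ[ℂ] E} (hB : B.IsSymmetric) (p q : ℝ) (c : E) :
    ‖(p : ℂ) • B c + (q * Complex.I) • c‖ ^ 2 = p ^ 2 * ‖B c‖ ^ 2 + q ^ 2 * ‖c‖ ^ 2 := by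
  have him : (inner ℂ (B c) c : ℂ).im = 0 := by
    have := hB c c
    have h2 := inner_conj_symm (𝕜 := ℂ) (B c) c
    rw [← this] at h2
    exact Complex.conj_eq_iff_im.1 h2
  rw [norm_add_sq (𝕜 := ℂ), inner_smul_left, inner_smul_right, norm_smul, norm_smul]
  have : RCLike.re ((starRingEnd ℂ) (p : ℂ) * (q * Complex.I * inner ℂ (B c) c)) = 0 := by
    simp [him]
  rw [this]
  simp only [norm_mul, Complex.norm_real, Complex.norm_I, Real.norm_eq_abs, mul_pow, sq_abs,
    one_pow]
  ring

theorem norm_inner_combination_le {B : E →ₗ[ℂ] E} (hB : B.IsSymmetric)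
    (hB1 : ∀ x, ‖B x‖ ≤ ‖x‖) (p q : ℝ) (a c : E) :
    ‖(p : ℂ) * inner ℂ a (B c) + (q * Complex.I) * inner ℂ a c‖
      ≤ √(p ^ 2 + q ^ 2) * (‖a‖ * ‖c‖) := by
  have h := norm_inner_le_norm (𝕜 := ℂ) a ((p : ℂ) • B c + (q * Complex.I) • c)
  rw [inner_add_right, inner_smul_right, inner_smul_right] at h
  refine h.trans ?_
  have : ‖(p : ℂ) • B c + (q * Complex.I) • c‖ ≤ √(p ^ 2 + q ^ 2) * ‖c‖ := by
    refine (sq_le_sq₀ (norm_nonneg _) (by positivity)).1 ?_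
    rw [norm_smul_add_I_smul_sq hB, mul_pow, Real.sq_sqrt (by positivity)]
    have := hB1 c
    have : ‖B c‖ ^ 2 ≤ ‖c‖ ^ 2 := by gcongr
    nlinarith [mul_le_mul_of_nonneg_left this (sq_nonneg p)]
  calc _ ≤ ‖a‖ * (√(p ^ 2 + q ^ 2) * ‖c‖) := by gcongr
    _ = _ := by ring

theorem sq_add_sq_le_of_linear_le {r i N : ℝ} (hN : 0 ≤ N)
    (h : r * r + i * i ≤ √(r ^ 2 + i ^ 2) * N) : r ^ 2 + i ^ 2 ≤ N ^ 2 := by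
  set t := √(r ^ 2 + i ^ 2) with ht
  have h2 : t ^ 2 = r ^ 2 + i ^ 2 := Real.sq_sqrt (by positivity)
  have h0 : 0 ≤ t := Real.sqrt_nonneg _
  have : t ≤ N := by
    rcases h0.eq_or_lt with h' | h'
    · rw [← h']; exact hN
    · nlinarith
  rw [← h2]; gcongr

/-- The left side is the real part of `⟨a, (p B + I q) c⟩` when `(p, q)` is the pair of real numbers
being bounded, up to sign; the operator `p B + I q` has norm at most `√(p² + q²)`, and one such
factor cancels. -/
theorem re_inner_sq_add_im_inner_sq_le {B : E →ₗ[ℂ] E} (hB : B.IsSymmetric)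
    (hB1 : ∀ x, ‖B x‖ ≤ ‖x‖) (a c : E) :
    (inner ℂ a (B c) : ℂ).re ^ 2 + (inner ℂ a c : ℂ).im ^ 2 ≤ (‖a‖ * ‖c‖) ^ 2 := by
  apply sq_add_sq_le_of_linear_le (by positivity)
  have h := (Complex.re_le_norm _).trans (norm_inner_combination_le hB hB1
    (inner ℂ a (B c) : ℂ).re (-(inner ℂ a c : ℂ).im) a c)
  simpa using h

theorem im_inner_sq_add_re_inner_sq_le {B : E →ₗ[ℂ] E} (hB : B.IsSymmetric)
    (hB1 : ∀ x, ‖B x‖ ≤ ‖x‖) (a c : E) :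
    (inner ℂ a (B c) : ℂ).im ^ 2 + (inner ℂ a c : ℂ).re ^ 2 ≤ (‖a‖ * ‖c‖) ^ 2 := by
  apply sq_add_sq_le_of_linear_le (by positivity)
  have h := ((le_abs_self _).trans (Complex.abs_im_le_norm _)).trans
    (norm_inner_combination_le hB hB1
    (inner ℂ a (B c) : ℂ).im ((inner ℂ a c : ℂ).re) a c)
  simpa using h

end Contraction

/-- The final comparison: `N = ‖a‖ ‖c‖`, `s = ‖a‖² + ‖c‖²`, and `R`, `I` are the parts of `⟨a, c⟩`.
Since `2 N ≤ s ≤ 1` gives `3 N ≤ 1 + s / 2`, it suffices to compare with `3 N`. -/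
theorem sqrt_add_sqrt_le {N R I s : ℝ} (hN : 0 ≤ N) (hs : 2 * N ≤ s) (hs1 : s ≤ 1)
    (hz : R ^ 2 + I ^ 2 ≤ N ^ 2) :
    2 * √(N ^ 2 - I ^ 2) + 2 * √(N ^ 2 - R ^ 2) ≤ 1 + s / 2 + √(N ^ 2 - (R ^ 2 + I ^ 2)) := by
  set p := √(N ^ 2 - I ^ 2)
  set q := √(N ^ 2 - R ^ 2)
  set t := √(N ^ 2 - (R ^ 2 + I ^ 2))
  have hp : p ^ 2 = N ^ 2 - I ^ 2 := Real.sq_sqrt (by nlinarith [sq_nonneg R])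
  have hq : q ^ 2 = N ^ 2 - R ^ 2 := Real.sq_sqrt (by nlinarith [sq_nonneg I])
  have ht : t ^ 2 = N ^ 2 - (R ^ 2 + I ^ 2) := Real.sq_sqrt (by nlinarith)
  have hp0 : 0 ≤ p := Real.sqrt_nonneg _
  have hq0 : 0 ≤ q := Real.sqrt_nonneg _
  have ht0 : 0 ≤ t := Real.sqrt_nonneg _
  have hpN : p ≤ N := abs_le_of_sq_le_sq' (by nlinarith [sq_nonneg I]) hN |>.2
  have hqN : q ≤ N := abs_le_of_sq_le_sq' (by nlinarith [sq_nonneg R]) hN |>.2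
  have key : 2 * (p + q) - 3 * N ≤ t := by
    by_cases h : 2 * (p + q) - 3 * N ≤ 0
    · linarith
    · apply abs_le_of_sq_le_sq' _ ht0 |>.2
      have h1 : t ^ 2 = p ^ 2 + q ^ 2 - N ^ 2 := by rw [ht, hp, hq]; ring
      rw [h1]
      push Not at h
      -- With `σ = p + q` and `p² + q² ≥ σ² / 2`, the claim reduces to `(σ - 2 N) (7 σ - 10 N) ≤ 0`;
      -- here `3 N / 2 < σ ≤ 2 N`.
      nlinarith [sq_nonneg (p - q), mul_nonneg (sub_nonneg.2 (add_le_add hpN hqN))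
        (show 0 ≤ 7 * (p + q) - 10 * N by linarith)]
  linarith

/-! ### The best overlap of two vectors with an orthonormal pair. -/

section Optimum

variable {E : Type*} [NormedAddCommGroup E] [InnerProductSpace ℂ E]

theorem exists_norm_eq_one_smul_norm_eq (h : ∃ e : E, e ≠ 0) (x : E) :
    ∃ g : E, ‖g‖ = 1 ∧ x = (‖x‖ : ℂ) • g := by
  have key : ∀ y : E, y ≠ 0 → ‖((‖y‖⁻¹ : ℝ) : ℂ) • y‖ = 1 := fun y hy => by
    rw [norm_smul, Complex.norm_real, norm_inv, norm_norm, inv_mul_cancel₀ (norm_ne_zero_iff.2 hy)]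
  by_cases hx : x = 0
  · obtain ⟨e, he⟩ := h
    exact ⟨_, key e he, by simp [hx]⟩
  · refine ⟨_, key x hx, ?_⟩
    rw [smul_smul, ← Complex.ofReal_mul, mul_inv_cancel₀ (norm_ne_zero_iff.2 hx)]
    simp

theorem orthonormal_pair {g₁ g₂ : E} (h₁ : ‖g₁‖ = 1) (h₂ : ‖g₂‖ = 1)
    (h : inner ℂ g₁ g₂ = (0 : ℂ)) : Orthonormal ℂ ![g₁, g₂] := by
  rw [orthonormal_iff_ite]
  intro i j
  have h' : inner ℂ g₂ g₁ = (0 : ℂ) := inner_eq_zero_symm.1 h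
  fin_cases i <;> fin_cases j <;> simp [h, h', h₁, h₂, inner_self_eq_norm_sq_to_K]

/-- Gram–Schmidt for `a`, `c`, allowing zero or parallel vectors. The pair `f₁`, `f₂` serves only to
show that the space has dimension at least two, so that a unit vector orthogonal to `e₁` exists. -/
theorem exists_orthonormal_coordinates {f₁ f₂ : E} (h₁ : ‖f₁‖ = 1) (h₂ : ‖f₂‖ = 1)
    (h : inner ℂ f₁ f₂ = (0 : ℂ)) (a c : E) :
    ∃ e₁ e₂ : E, ∃ (z : ℂ) (r : ℝ), 0 ≤ r ∧ ‖e₁‖ = 1 ∧ ‖e₂‖ = 1 ∧ inner ℂ e₁ e₂ = (0 : ℂ) ∧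
      a = (‖a‖ : ℂ) • e₁ ∧ c = z • e₁ + (r : ℂ) • e₂ := by
  have hf1 : f₁ ≠ 0 := norm_ne_zero_iff.1 (by rw [h₁]; exact one_ne_zero)
  have hf2 : f₂ ≠ 0 := norm_ne_zero_iff.1 (by rw [h₂]; exact one_ne_zero)
  obtain ⟨e₁, he₁, ha⟩ := exists_norm_eq_one_smul_norm_eq ⟨f₁, hf1⟩ a
  have hself : inner ℂ e₁ e₁ = (1 : ℂ) := by
    rw [inner_self_eq_norm_sq_to_K, he₁]; simp
  have hex : ∃ e : (Submodule.span ℂ {e₁})ᗮ, e ≠ 0 := by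
    by_contra hcon
    push Not at hcon
    have hmem : ∀ y : E, y - (inner ℂ e₁ y : ℂ) • e₁ = 0 := fun y => by
      have hy : y - (inner ℂ e₁ y : ℂ) • e₁ ∈ (Submodule.span ℂ {e₁})ᗮ := by
        rw [Submodule.mem_orthogonal_singleton_iff_inner_right, inner_sub_right,
          inner_smul_right, hself]
        simp
      exact congrArg Subtype.val (hcon ⟨_, hy⟩)
    have e1 := sub_eq_zero.1 (hmem f₁)
    have e2 := sub_eq_zero.1 (hmem f₂)
    rw [e1, e2, inner_smul_left, inner_smul_right, hself] at h
    simp only [mul_one, mul_eq_zero, map_eq_zero] at h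
    rcases h with h | h
    · rw [h, zero_smul] at e1; exact hf1 e1
    · rw [h, zero_smul] at e2; exact hf2 e2
  have hy : c - (inner ℂ e₁ c : ℂ) • e₁ ∈ (Submodule.span ℂ {e₁})ᗮ := by
    rw [Submodule.mem_orthogonal_singleton_iff_inner_right, inner_sub_right,
      inner_smul_right, hself]
    simp
  obtain ⟨g, hg, hc⟩ := exists_norm_eq_one_smul_norm_eq hex
    (⟨_, hy⟩ : (Submodule.span ℂ {e₁})ᗮ)
  refine ⟨e₁, g, inner ℂ e₁ c, _, norm_nonneg (c - (inner ℂ e₁ c : ℂ) • e₁), he₁, hg, ?_, ha, ?_⟩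
  · exact (Submodule.mem_orthogonal_singleton_iff_inner_right).1 g.2
  · have := congrArg Subtype.val hc
    simp only [Submodule.coe_smul] at this
    exact sub_eq_iff_eq_add'.1 this

/-- In coordinates, `a` and `c` are the columns of a 2 × 2 matrix, and the right side is the square
of its trace norm: the sum of the squared entries plus twice `|det|`, whose square is the Gram
determinant. The pair is the unitary factor of the polar decomposition. -/
theorem exists_orthonormal_pair_inner_add_inner {f₁ f₂ : E} (h₁ : ‖f₁‖ = 1) (h₂ : ‖f₂‖ = 1)
    (h : inner ℂ f₁ f₂ = (0 : ℂ)) (a c : E) :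
    ∃ g₁ g₂ : E, ‖g₁‖ = 1 ∧ ‖g₂‖ = 1 ∧ inner ℂ g₁ g₂ = (0 : ℂ) ∧
      ‖(inner ℂ g₁ a + inner ℂ g₂ c : ℂ)‖ ^ 2 =
        ‖a‖ ^ 2 + ‖c‖ ^ 2 + 2 * √((‖a‖ * ‖c‖) ^ 2 - ‖(inner ℂ a c : ℂ)‖ ^ 2) := by
  obtain ⟨e₁, e₂, z, r, hr, he₁, he₂, he, ha, hc⟩ := exists_orthonormal_coordinates h₁ h₂ h a c
  set A := ‖a‖ with hA
  have hA0 : 0 ≤ A := norm_nonneg _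
  have i11 : inner ℂ e₁ e₁ = (1 : ℂ) := by rw [inner_self_eq_norm_sq_to_K, he₁]; simp
  have i22 : inner ℂ e₂ e₂ = (1 : ℂ) := by rw [inner_self_eq_norm_sq_to_K, he₂]; simp
  have i21 : inner ℂ e₂ e₁ = (0 : ℂ) := inner_eq_zero_symm.1 he
  have hnorm : ∀ x y : ℂ, ‖x • e₁ + y • e₂‖ ^ 2 = ‖x‖ ^ 2 + ‖y‖ ^ 2 := fun x y => by
    rw [norm_add_sq (𝕜 := ℂ), inner_smul_left, inner_smul_right, he, norm_smul, norm_smul,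
      he₁, he₂]
    simp
  have hinner : ∀ x y x' y' : ℂ, (inner ℂ (x • e₁ + y • e₂) (x' • e₁ + y' • e₂) : ℂ)
      = starRingEnd ℂ x * x' + starRingEnd ℂ y * y' := fun x y x' y' => by
    simp only [inner_add_left, inner_add_right, inner_smul_left, inner_smul_right, i11, i22, i21,
      he]
    ring
  have ha' : a = (A : ℂ) • e₁ + (0 : ℂ) • e₂ := by rw [zero_smul, add_zero]; exact ha
  have hcn : ‖c‖ ^ 2 = ‖z‖ ^ 2 + r ^ 2 := by
    rw [hc, hnorm, Complex.norm_real, Real.norm_eq_abs, sq_abs]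
  have hac : ‖(inner ℂ a c : ℂ)‖ ^ 2 = A ^ 2 * ‖z‖ ^ 2 := by
    rw [ha', hc, hinner]
    simp [mul_pow, abs_of_nonneg hA0]
  have hdet : √((A * ‖c‖) ^ 2 - ‖(inner ℂ a c : ℂ)‖ ^ 2) = A * r := by
    rw [hac, mul_pow, hcn]
    rw [show A ^ 2 * (‖z‖ ^ 2 + r ^ 2) - A ^ 2 * ‖z‖ ^ 2 = (A * r) ^ 2 by ring]
    exact Real.sqrt_sq (by positivity)
  rw [hdet, hcn]
  set T : ℝ := (A + r) ^ 2 + ‖z‖ ^ 2 with hT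
  have hT0 : 0 ≤ T := by positivity
  have htarget : A ^ 2 + (‖z‖ ^ 2 + r ^ 2) + 2 * (A * r) = T := by rw [hT]; ring
  rw [htarget]
  rcases hT0.eq_or_lt with hz | hpos
  -- Here `a = c = 0`, so any orthonormal pair will do.
  · refine ⟨f₁, f₂, h₁, h₂, h, ?_⟩
    have hA' : A = 0 := by nlinarith [sq_nonneg ‖z‖, sq_nonneg (A + r)]
    have hc' : c = 0 := by
      rw [← norm_eq_zero, ← sq_eq_zero_iff, hcn]
      nlinarith [sq_nonneg ‖z‖, sq_nonneg (A + r)]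
    have ha0 : a = 0 := norm_eq_zero.1 hA'
    rw [← hz, ha0, hc']; simp
  · set t := √T with ht
    have ht2 : t ^ 2 = T := Real.sq_sqrt hT0
    have htpos : 0 < t := Real.sqrt_pos.2 hpos
    have htC : (t : ℂ) ≠ 0 := by exact_mod_cast htpos.ne'
    have hzz : starRingEnd ℂ z * z = ((‖z‖ ^ 2 : ℝ) : ℂ) := by
      rw [Complex.conj_mul']; push_cast; rfl
    -- The matrix with columns `(A, 0)` and `(z, r)`, plus its transposed cofactor conjugate with
    -- columns `(r, -z̄)` and `(0, A)`, is `t` times a unitary; these are the columns of that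
    -- unitary.
    refine ⟨(((A + r) / t : ℝ) : ℂ) • e₁ + (-(starRingEnd ℂ z) / t) • e₂,
      (z / t) • e₁ + (((A + r) / t : ℝ) : ℂ) • e₂, ?_, ?_, ?_, ?_⟩
    · rw [← sq_eq_sq₀ (norm_nonneg _) zero_le_one, hnorm]
      simp only [Complex.norm_real, norm_div, norm_neg, Real.norm_eq_abs, sq_abs, div_pow,
        RCLike.norm_conj, ht2]
      rw [← add_div, one_pow, ← hT, div_self hpos.ne']
    · rw [← sq_eq_sq₀ (norm_nonneg _) zero_le_one, hnorm]
      simp only [Complex.norm_real, norm_div, Real.norm_eq_abs, sq_abs, div_pow, ht2]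
      rw [← add_div, one_pow, add_comm, ← hT, div_self hpos.ne']
    · rw [hinner]
      simp only [Complex.conj_ofReal, map_div₀, map_neg, Complex.conj_conj]
      push_cast
      ring
    · have : (inner ℂ ((((A + r) / t : ℝ) : ℂ) • e₁ + (-(starRingEnd ℂ z) / t) • e₂) a
          + inner ℂ ((z / t) • e₁ + (((A + r) / t : ℝ) : ℂ) • e₂) c : ℂ) = (t : ℂ) := by
        rw [ha', hc, hinner, hinner]
        simp only [Complex.conj_ofReal, map_div₀]
        have : (t : ℂ) * t = ((A + r) ^ 2 + starRingEnd ℂ z * z) := by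
          rw [hzz]; exact_mod_cast (sq t).symm.trans ht2
        field_simp
        push_cast
        field_simp
        rw [sq (t : ℂ), this]; ring
      rw [this, Complex.norm_real, Real.norm_eq_abs, sq_abs, ht2]

end Optimum

/-! ### Unitary matrices: action on vectors, transitivity on orthonormal families, compactness. -/

section UnitaryMatrices

variable {m : Type*} [Fintype m]

theorem applyOp_eq_toEuclideanLin [DecidableEq m] (M : Matrix m m ℂ) (ψ : EuclideanSpace ℂ m) :
    applyOp M ψ = Matrix.toEuclideanLin M ψ := rfl

theorem applyOp_mul (M N : Matrix m m ℂ) (ψ : EuclideanSpace ℂ m) :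
    applyOp (M * N) ψ = applyOp M (applyOp N ψ) := by
  simp [applyOp, Matrix.mulVec_mulVec]

theorem applyOp_one [DecidableEq m] (ψ : EuclideanSpace ℂ m) :
    applyOp (1 : Matrix m m ℂ) ψ = ψ := by
  simp [applyOp]

theorem inner_applyOp_left (M : Matrix m m ℂ) (ψ φ : EuclideanSpace ℂ m) :
    inner ℂ (applyOp M ψ) φ = (inner ℂ ψ (applyOp Mᴴ φ) : ℂ) := by
  rw [inner_eq_star_dotProduct, inner_eq_star_dotProduct, applyOp, applyOp]
  simp only
  rw [Matrix.star_mulVec, Matrix.dotProduct_mulVec]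

theorem norm_applyOp_of_mem_unitary [DecidableEq m] {U : Matrix m m ℂ}
    (hU : U ∈ Matrix.unitaryGroup m ℂ) (ψ : EuclideanSpace ℂ m) : ‖applyOp U ψ‖ = ‖ψ‖ := by
  have h : inner ℂ (applyOp U ψ) (applyOp U ψ) = (inner ℂ ψ ψ : ℂ) := by
    rw [inner_applyOp_left, ← applyOp_mul, ← Matrix.star_eq_conjTranspose,
      Matrix.mem_unitaryGroup_iff'.1 hU, applyOp_one]
  rw [inner_self_eq_norm_sq_to_K, inner_self_eq_norm_sq_to_K] at h
  have h2 : ‖applyOp U ψ‖ ^ 2 = ‖ψ‖ ^ 2 := by exact_mod_cast h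
  exact (sq_eq_sq₀ (norm_nonneg _) (norm_nonneg _)).1 h2

theorem inner_applyOp_applyOp_of_mem_unitary [DecidableEq m] {U : Matrix m m ℂ}
    (hU : U ∈ Matrix.unitaryGroup m ℂ) (ψ φ : EuclideanSpace ℂ m) :
    inner ℂ (applyOp U ψ) (applyOp U φ) = (inner ℂ ψ φ : ℂ) := by
  rw [inner_applyOp_left, ← applyOp_mul, ← Matrix.star_eq_conjTranspose,
      Matrix.mem_unitaryGroup_iff'.1 hU, applyOp_one]

theorem exists_mem_unitary_applyOp_eq [DecidableEq m]
    (L : EuclideanSpace ℂ m ≃ₗᵢ[ℂ] EuclideanSpace ℂ m) :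
    ∃ U ∈ Matrix.unitaryGroup m ℂ, ∀ ψ, applyOp U ψ = L ψ := by
  let T := Matrix.toEuclideanCLM (𝕜 := ℂ) (n := m)
  let V : EuclideanSpace ℂ m →L[ℂ] EuclideanSpace ℂ m := (Unitary.linearIsometryEquiv.symm L).1
  have hV : star V * V = 1 := Unitary.star_mul_self_of_mem (Unitary.linearIsometryEquiv.symm L).2
  have hT : T (T.symm V) = V := T.apply_symm_apply V
  refine ⟨T.symm V, ?_, fun ψ => ?_⟩
  · rw [Matrix.mem_unitaryGroup_iff']
    have h : T (star (T.symm V) * T.symm V) = T 1 := by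
      rw [map_mul, map_star, hT, hV, map_one]
    exact T.injective h
  · exact congrArg (fun f : EuclideanSpace ℂ m →L[ℂ] EuclideanSpace ℂ m => f ψ) hT

theorem exists_mem_unitary_orthonormal [DecidableEq m] {r : ℕ}
    {g f : Fin r → EuclideanSpace ℂ m} (hg : Orthonormal ℂ g) (hf : Orthonormal ℂ f) :
    ∃ U ∈ Matrix.unitaryGroup m ℂ, ∀ i, applyOp U (g i) = f i := by
  have hcard : r ≤ Fintype.card m := by
    simpa using hg.linearIndependent.fintype_card_le_finrank
  have hext : ∀ v : Fin r → EuclideanSpace ℂ m, Orthonormal ℂ v →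
      ∃ b : OrthonormalBasis (Fin (Fintype.card m)) ℂ (EuclideanSpace ℂ m),
        ∀ i, b (Fin.castLE hcard i) = v i := fun v hv => by
    -- The padding by `0` is irrelevant: the basis is required to agree with `w` only on the first
    -- `r` indices.
    let w : Fin (Fintype.card m) → EuclideanSpace ℂ m :=
      fun j => if h : (j : ℕ) < r then v ⟨j, h⟩ else 0
    have hw : Orthonormal ℂ (Set.domRestrict (Set.range (Fin.castLE hcard)) w) := by
      let e : Set.range (Fin.castLE hcard) → Fin r := fun j => ⟨j.1, by
        obtain ⟨_, i, rfl⟩ := j; exact i.2⟩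
      have he : Function.Injective e := fun x y hxy => by
        have : (x.1 : ℕ) = y.1 := congrArg (fun i : Fin r => (i : ℕ)) hxy
        exact Subtype.ext (Fin.ext this)
      have heq : Set.domRestrict (Set.range (Fin.castLE hcard)) w = v ∘ e := by
        funext j
        have hj : (j.1 : ℕ) < r := (e j).2
        exact dif_pos hj
      rw [heq]; exact hv.comp e he
    obtain ⟨b, hb⟩ := hw.exists_orthonormalBasis_extension_of_card_eq (by simp)
    refine ⟨b, fun i => ?_⟩
    rw [hb _ ⟨i, rfl⟩]
    simp [w]
  obtain ⟨b, hb⟩ := hext g hg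
  obtain ⟨b', hb'⟩ := hext f hf
  obtain ⟨U, hU, h⟩ := exists_mem_unitary_applyOp_eq (b.equiv b' (Equiv.refl _))
  refine ⟨U, hU, fun i => ?_⟩
  rw [h, ← hb, ← hb']
  simp

instance compactSpace_unitaryGroup [DecidableEq m] : CompactSpace (Matrix.unitaryGroup m ℂ) := by
  refine (isCompact_iff_compactSpace
    (X := Matrix m m ℂ) (s := (Matrix.unitaryGroup m ℂ : Set (Matrix m m ℂ)))).1 ?_
  have hsub : (Matrix.unitaryGroup m ℂ : Set (Matrix m m ℂ)) ⊆
      Set.pi Set.univ fun _ => Set.pi Set.univ fun _ => Metric.closedBall (0 : ℂ) 1 := by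
    intro U hU i _ j _
    simpa using entry_norm_bound_of_unitary hU i j
  refine IsCompact.of_isClosed_subset (isCompact_univ_pi fun _ => isCompact_univ_pi fun _ =>
    isCompact_closedBall _ _) ?_ hsub
  have : (Matrix.unitaryGroup m ℂ : Set (Matrix m m ℂ)) = {U | U * Uᴴ = 1} := by
    ext U
    exact Matrix.mem_unitaryGroup_iff
  rw [this]
  exact isClosed_eq (by fun_prop) continuous_const

end UnitaryMatrices

/-! ### Phases and signs of bit strings. -/

section BitStrings

variable {ι : Type*} [Fintype ι]

/-- The relative phase `I ^ Δ(y)` of the basis state `y`. -/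
noncomputable def phase (y : BitString ι) : ℂ := Complex.I ^ hammingWeight y

theorem pow_hammingWeight {R : Type*} [CommMonoid R] (r : R) (y : BitString ι) :
    r ^ hammingWeight y = ∏ i, r ^ (y i : ℕ) := by
  rw [hammingWeight, Finset.prod_pow_eq_pow_sum]

theorem conj_phase_mul_phase (y : BitString ι) : starRingEnd ℂ (phase y) * phase y = 1 := by
  rw [Complex.conj_mul', phase]; simp

theorem sum_neg_one_pow_hammingWeight [DecidableEq ι] [Nonempty ι] {R : Type*} [CommRing R] :
    ∑ y : BitString ι, (-1 : R) ^ hammingWeight y = 0 := by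
  simp_rw [pow_hammingWeight]
  rw [← Fintype.prod_sum fun (_ : ι) (b : Fin 2) => (-1 : R) ^ (b : ℕ)]
  simp

theorem phase_sq (y : BitString ι) : phase y * phase y = (-1) ^ hammingWeight y := by
  rw [phase, ← mul_pow, Complex.I_mul_I]

theorem card_bitString [DecidableEq ι] : Fintype.card (BitString ι) = 2 ^ Fintype.card ι := by
  simp

end BitStrings

/-! ### Honest gates and the observables they measure. -/

section Gates

/-- The observable measured by a party: `Z` on input `0`, `X` on input `1`. -/
def pauliObservable (x : Fin 2) : Matrix (Fin 2) (Fin 2) ℝ :=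
  if x = 0 then !![1, 0; 0, -1] else !![0, 1; 1, 0]

theorem inv_sqrt_two_mul_self : ((√2 : ℝ) : ℂ)⁻¹ * ((√2 : ℝ) : ℂ)⁻¹ = 1 / 2 := by
  rw [← mul_inv, ← Complex.ofReal_mul, Real.mul_self_sqrt (by norm_num)]; norm_num

theorem sum_conj_inputGate_mul (x z z' : Fin 2) :
    ∑ y, starRingEnd ℂ (inputGate x y z) * inputGate x y z' = if z = z' then 1 else 0 := by
  have h := inv_sqrt_two_mul_self
  fin_cases x <;> fin_cases z <;> fin_cases z' <;> simp [inputGate, h] <;> norm_num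

theorem sum_neg_one_pow_conj_inputGate_mul (x z z' : Fin 2) :
    ∑ y : Fin 2, (-1 : ℂ) ^ (y : ℕ) * (starRingEnd ℂ (inputGate x y z) * inputGate x y z') =
      (pauliObservable x z z' : ℂ) := by
  have h := inv_sqrt_two_mul_self
  fin_cases x <;> fin_cases z <;> fin_cases z' <;>
    simp [inputGate, pauliObservable, h] <;> norm_num

/-- The algebraic core of the test: `Z + I X` has rank one. Taking tensor products, the
phase-weighted sum of all honest observables factors in `z` and `z'`. -/
theorem sum_I_pow_mul_pauliObservable (z z' : Fin 2) :
    ∑ x : Fin 2, Complex.I ^ (x : ℕ) * (pauliObservable x z z' : ℂ) =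
      Complex.I ^ (z : ℕ) * Complex.I ^ (z' : ℕ) := by
  fin_cases z <;> fin_cases z' <;> simp [pauliObservable]

variable {n : ℕ} (H : Finset (Fin n))

/-- The matrix entries of the product of the observables measured by the honest parties. -/
def parityObservable (x z z' : HonestLabel H) : ℝ := ∏ i, pauliObservable (x i) (z i) (z' i)

theorem sum_conj_honestGates_mul (x z z' : HonestLabel H) :
    ∑ y, starRingEnd ℂ (honestGates H x y z) * honestGates H x y z' =
      if z = z' then 1 else 0 := by
  simp only [honestGates, Matrix.of_apply, map_prod, ← Finset.prod_mul_distrib]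
  rw [← Fintype.prod_sum fun (i : {i : Fin n // i ∈ H}) (b : Fin 2) =>
    starRingEnd ℂ (inputGate (x i) b (z i)) * inputGate (x i) b (z' i)]
  simp only [sum_conj_inputGate_mul, Finset.prod_ite_zero, funext_iff, Finset.mem_univ,
    true_imp_iff, Finset.prod_const_one]

theorem sum_neg_one_pow_conj_honestGates_mul (x z z' : HonestLabel H) :
    ∑ y : HonestLabel H, (-1 : ℂ) ^ hammingWeight y *
      (starRingEnd ℂ (honestGates H x y z) * honestGates H x y z') =
      (parityObservable H x z z' : ℂ) := by
  simp only [honestGates, Matrix.of_apply, map_prod, ← Finset.prod_mul_distrib, pow_hammingWeight]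
  rw [← Fintype.prod_sum fun (i : {i : Fin n // i ∈ H}) (b : Fin 2) => (-1 : ℂ) ^ (b : ℕ) *
    (starRingEnd ℂ (inputGate (x i) b (z i)) * inputGate (x i) b (z' i))]
  simp only [sum_neg_one_pow_conj_inputGate_mul, parityObservable, Complex.ofReal_prod]

theorem sum_phase_mul_parityObservable (z z' : HonestLabel H) :
    ∑ x : HonestLabel H, phase x * (parityObservable H x z z' : ℂ) = phase z * phase z' := by
  simp only [phase, pow_hammingWeight, parityObservable, Complex.ofReal_prod,
    ← Finset.prod_mul_distrib]
  rw [← Fintype.prod_sum fun (i : {i : Fin n // i ∈ H}) (b : Fin 2) => Complex.I ^ (b : ℕ) *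
    (pauliObservable b (z i) (z' i) : ℂ)]
  simp only [sum_I_pow_mul_pauliObservable]

theorem hammingWeight_eq_add (x : BitString (Fin n)) :
    hammingWeight x = hammingWeight (honestPart H x) + hammingWeight (dishonestPart H x) := by
  simp only [hammingWeight, honestPart, dishonestPart]
  convert! (Fintype.sum_subtype_add_sum_subtype (· ∈ H) fun i => (x i : ℕ)).symm

theorem phase_eq_mul (x : BitString (Fin n)) :
    phase x = phase (honestPart H x) * phase (dishonestPart H x) := by
  rw [phase, hammingWeight_eq_add H, pow_add]; rfl

theorem honestPart_joinBits (h : HonestLabel H) (d : DishonestBits H) :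
    honestPart H (joinBits H h d) = h := by
  funext i; simp [honestPart, joinBits]

theorem dishonestPart_joinBits (h : HonestLabel H) (d : DishonestBits H) :
    dishonestPart H (joinBits H h d) = d := by
  funext i; simp [dishonestPart, joinBits, i.2]

theorem sum_bitString_eq {R : Type*} [AddCommMonoid R] (F : HonestLabel H → DishonestBits H → R) :
    ∑ x : BitString (Fin n), F (honestPart H x) (dishonestPart H x) = ∑ h, ∑ d, F h d := by
  rw [← Fintype.sum_prod_type']
  exact Fintype.sum_equiv (Equiv.piEquivPiSubtypeProd (· ∈ H) fun _ => Fin 2) _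
    (fun p : HonestLabel H × DishonestBits H => F p.1 p.2) fun _ => rfl

theorem re_I_pow_eq (m : ℕ) :
    (Complex.I ^ m).re = if m % 4 = 0 then 1 else if m % 4 = 2 then -1 else 0 := by
  rw [Complex.I_pow_eq_pow_mod]
  have : m % 4 < 4 := Nat.mod_lt _ (by norm_num)
  interval_cases m % 4 <;> simp [pow_succ]

/-- This one quantity encodes both the restriction to inputs of even sum and the sign that the
acceptance rule attaches to them. -/
theorem re_phase_eq (x : BitString (Fin n)) :
    (phase x).re = if hammingWeight x % 2 = 0 then (-1) ^ (hammingWeight x / 2) else 0 := by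
  rw [phase]
  rcases Nat.even_or_odd' (hammingWeight x) with ⟨m, hm | hm⟩
  · rw [hm, pow_mul, Complex.I_sq]
    simp only [Nat.mul_mod_right, if_true, Nat.mul_div_cancel_left m two_pos]
    norm_cast
  · rw [hm, pow_succ, pow_mul, Complex.I_sq]
    have h1 : (2 * m + 1) % 2 ≠ 0 := by omega
    rw [if_neg h1]
    rcases neg_one_pow_eq_or ℂ m with h | h <;> simp [h]

end Gates

/-! ### The parity observable of a POVM is a Hermitian contraction. -/

section Measurements

variable {m : Type*} [Fintype m] [DecidableEq m]

theorem norm_applyOp_reflection_le {E : Matrix m m ℂ} (hE : E.PosSemidef)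
    (hE1 : (1 - E).PosSemidef) (c : EuclideanSpace ℂ m) :
    ‖applyOp (1 - (2 : ℂ) • E) c‖ ≤ ‖c‖ := by
  have hEH : Eᴴ = E := hE.1
  have hE1H : (1 - E)ᴴ = 1 - E := hE1.1
  -- `E - E² = E (1 - E) E + (1 - E) E (1 - E)`, a sum of two positive terms.
  have hpsd : (E - E * E).PosSemidef := by
    have h1 := hE1.conjTranspose_mul_mul_same E
    have h2 := hE.conjTranspose_mul_mul_same (1 - E)
    rw [hEH] at h1
    rw [hE1H] at h2
    have := h1.add h2
    convert this using 1
    noncomm_ring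
  have hB : (1 - (2 : ℂ) • E)ᴴ * (1 - (2 : ℂ) • E) = 1 - (4 : ℂ) • (E - E * E) := by
    rw [Matrix.conjTranspose_sub, Matrix.conjTranspose_smul, hEH, Matrix.conjTranspose_one]
    simp only [mul_sub, sub_mul, Matrix.smul_mul, Matrix.mul_smul, one_mul, mul_one, star_ofNat]
    module
  have h : inner ℂ (applyOp (1 - (2 : ℂ) • E) c) (applyOp (1 - (2 : ℂ) • E) c)
      = (inner ℂ c c - 4 * (star c.ofLp ⬝ᵥ (E - E * E) *ᵥ c.ofLp) : ℂ) := by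
    rw [inner_applyOp_left, ← applyOp_mul, hB, inner_eq_star_dotProduct, inner_eq_star_dotProduct,
      applyOp]
    simp only [Matrix.sub_mulVec (1 : Matrix m m ℂ), Matrix.smul_mulVec,
      Matrix.one_mulVec, dotProduct_sub, dotProduct_smul, smul_eq_mul]
  have hre := congrArg Complex.re h
  have hnn := (Complex.le_def.1 (hpsd.dotProduct_mulVec_nonneg c.ofLp)).1
  rw [inner_self_eq_norm_sq_to_K, inner_self_eq_norm_sq_to_K] at hre
  have h4 : ‖applyOp (1 - (2 : ℂ) • E) c‖ ^ 2
      = ‖c‖ ^ 2 - 4 * (star c.ofLp ⬝ᵥ (E - E * E) *ᵥ c.ofLp).re := by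
    simpa [← Complex.ofReal_pow] using hre
  rw [Complex.zero_re] at hnn
  exact (sq_le_sq₀ (norm_nonneg _) (norm_nonneg _)).1 (by linarith)

variable {ι : Type*} [Fintype ι] [DecidableEq ι]

/-- The observable of the parity of the outcome of a measurement. -/
noncomputable def POVM.parity (P : POVM (BitString ι) m) : Matrix m m ℂ :=
  ∑ d, ((-1 : ℂ) ^ hammingWeight d) • P.effect d

theorem POVM.parity_isHermitian (P : POVM (BitString ι) m) : P.parity.IsHermitian := by
  rw [POVM.parity, Matrix.IsHermitian, Matrix.conjTranspose_sum]
  refine Finset.sum_congr rfl fun d _ => ?_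
  rw [Matrix.conjTranspose_smul, (P.posSemidef d).1]
  simp

theorem POVM.parity_isSymmetric (P : POVM (BitString ι) m) :
    (Matrix.toEuclideanLin P.parity).IsSymmetric :=
  Matrix.isSymmetric_toEuclideanLin_iff.2 P.parity_isHermitian

theorem POVM.norm_parity_le (P : POVM (BitString ι) m) (c : EuclideanSpace ℂ m) :
    ‖Matrix.toEuclideanLin P.parity c‖ ≤ ‖c‖ := by
  rw [← applyOp_eq_toEuclideanLin]
  set odd : Finset (BitString ι) := Finset.univ.filter fun d => hammingWeight d % 2 = 1
  have hsplit : ∑ d ∈ odd, P.effect d + ∑ d ∈ oddᶜ, P.effect d = 1 := by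
    rw [Finset.sum_add_sum_compl, P.sum_effect]
  have hparity : P.parity = 1 - (2 : ℂ) • ∑ d ∈ odd, P.effect d := by
    have h1 : ∑ d ∈ odd, ((-1 : ℂ) ^ hammingWeight d) • P.effect d
        = -∑ d ∈ odd, P.effect d := by
      rw [← Finset.sum_neg_distrib]
      refine Finset.sum_congr rfl fun d hd => ?_
      have hd : hammingWeight d % 2 = 1 := by simpa [odd] using hd
      rw [(Nat.odd_iff.2 hd).neg_one_pow, neg_one_smul]
    have h2 : ∑ d ∈ oddᶜ, ((-1 : ℂ) ^ hammingWeight d) • P.effect d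
        = ∑ d ∈ oddᶜ, P.effect d := by
      refine Finset.sum_congr rfl fun d hd => ?_
      have hd : hammingWeight d % 2 = 0 := by simpa [odd] using hd
      rw [(Nat.even_iff.2 hd).neg_one_pow, one_smul]
    rw [POVM.parity, ← Finset.sum_add_sum_compl odd, h1, h2, ← hsplit]
    module
  rw [hparity]
  refine norm_applyOp_reflection_le (Matrix.posSemidef_sum _ fun d _ => P.posSemidef d) ?_ c
  rw [← hsplit, add_sub_cancel_left]
  exact Matrix.posSemidef_sum _ fun d _ => P.posSemidef d

end Measurements

/-! ### Components of a bipartite vector along the honest basis. -/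

section Slices

variable {l m : Type*} [Fintype l] [Fintype m]

/-- The component along `|h⟩` of a vector of a bipartite system. -/
noncomputable def slice (Ψ : EuclideanSpace ℂ (l × m)) (h : l) : EuclideanSpace ℂ m :=
  WithLp.toLp 2 fun q => Ψ (h, q)

theorem inner_eq_sum_inner_slice (Ψ Φ : EuclideanSpace ℂ (l × m)) :
    (inner ℂ Ψ Φ : ℂ) = ∑ h, inner ℂ (slice Ψ h) (slice Φ h) := by
  simp only [PiLp.inner_apply, slice, Fintype.sum_prod_type]

theorem sum_norm_slice_sq (Ψ : EuclideanSpace ℂ (l × m)) :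
    ∑ h, ‖slice Ψ h‖ ^ 2 = ‖Ψ‖ ^ 2 := by
  simp only [EuclideanSpace.norm_sq_eq, slice, Fintype.sum_prod_type]

theorem slice_applyOp_kronecker (M : Matrix l l ℂ) (N : Matrix m m ℂ)
    (Ψ : EuclideanSpace ℂ (l × m)) (h : l) :
    slice (applyOp (M ⊗ₖ N) Ψ) h = ∑ h', M h h' • applyOp N (slice Ψ h') := by
  ext q
  simp only [slice, applyOp, Matrix.mulVec, dotProduct, Matrix.kroneckerMap_apply,
    Fintype.sum_prod_type, WithLp.ofLp_sum, Finset.sum_apply, WithLp.ofLp_smul, Pi.smul_apply,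
    smul_eq_mul, Finset.mul_sum, mul_assoc]

end Slices

/-! ### The acceptance probability as a sum of correlations. -/

section Acceptance

variable {n : ℕ} (H : Finset (Fin n)) {A : Type*} [Fintype A] [DecidableEq A]

/-- The (unnormalized) state of the dishonest parties after a projection of the honest qubits
onto the vector with coefficients `phase`. -/
noncomputable def phaseComponent (Ψ : JointSpace H A) : EuclideanSpace ℂ (DishonestLabel H A) :=
  ∑ h, starRingEnd ℂ (phase h) • slice Ψ h

/-- The (unnormalized) state of the dishonest parties after a projection of the honest qubits
onto the vector with the conjugates of `phase` as coefficients. -/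
noncomputable def conjPhaseComponent (Ψ : JointSpace H A) :
    EuclideanSpace ℂ (DishonestLabel H A) :=
  ∑ h, phase h • slice Ψ h

theorem slice_rotatedState (Ψ : JointSpace H A) (x : BitString (Fin n)) (h : HonestLabel H) :
    slice (rotatedState H Ψ x) h = ∑ z, honestGates H (honestPart H x) h z • slice Ψ z := by
  simp only [rotatedState, slice_applyOp_kronecker, applyOp_one]

theorem outcomeProb_eq (Ψ : JointSpace H A) (S : Strategy H A) (x y : BitString (Fin n)) :
    outcomeProb H Ψ S x y =
      (inner ℂ (slice (rotatedState H Ψ x) (honestPart H y))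
        (Matrix.toEuclideanLin ((S (dishonestPart H x)).effect (dishonestPart H y))
          (slice (rotatedState H Ψ x) (honestPart H y))) : ℂ).re := by
  rw [outcomeProb, inner_eq_sum_inner_slice]
  congr 1
  simp only [slice_applyOp_kronecker, Matrix.single_apply]
  rw [Finset.sum_eq_single (honestPart H y), Finset.sum_eq_single (honestPart H y)]
  · simp [applyOp_eq_toEuclideanLin]
  · intro b _ hb; simp [hb.symm]
  · simp
  · intro b _ hb; simp [hb.symm]
  · simp

theorem sum_weighted_inner_rotatedState (w : HonestLabel H → ℂ)
    (L : EuclideanSpace ℂ (DishonestLabel H A) →ₗ[ℂ] EuclideanSpace ℂ (DishonestLabel H A))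
    (Ψ : JointSpace H A) (x : BitString (Fin n)) :
    ∑ h, w h * inner ℂ (slice (rotatedState H Ψ x) h) (L (slice (rotatedState H Ψ x) h)) =
      ∑ z, ∑ z', (∑ h, w h * (starRingEnd ℂ (honestGates H (honestPart H x) h z) *
        honestGates H (honestPart H x) h z')) * inner ℂ (slice Ψ z) (L (slice Ψ z')) := by
  simp only [slice_rotatedState, map_sum, map_smul, sum_inner, inner_sum, inner_smul_left,
    inner_smul_right, Finset.mul_sum, Finset.sum_mul]
  rw [Finset.sum_comm]
  conv_rhs => rw [Finset.sum_comm]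
  refine Finset.sum_congr rfl fun z _ => ?_
  rw [Finset.sum_comm]
  refine Finset.sum_congr rfl fun z' _ => Finset.sum_congr rfl fun h _ => ?_
  ring

theorem sum_norm_slice_rotatedState_sq (Ψ : JointSpace H A) (x : BitString (Fin n)) :
    ∑ h, ‖slice (rotatedState H Ψ x) h‖ ^ 2 = ‖Ψ‖ ^ 2 := by
  have h := sum_weighted_inner_rotatedState H (fun _ => 1) LinearMap.id Ψ x
  simp only [one_mul, sum_conj_honestGates_mul, LinearMap.id_apply, ite_mul, zero_mul,
    Finset.sum_ite_eq, Finset.mem_univ, if_true, inner_self_eq_norm_sq_to_K] at h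
  rw [← sum_norm_slice_sq]
  exact_mod_cast h

/-- The correlation between the parities of the outcomes of the honest and of the dishonest
parties, up to the factor `phase`, when the dishonest inputs are `d` and the honest ones are
averaged. -/
noncomputable def correlation (Ψ : JointSpace H A) (S : Strategy H A) (d : DishonestBits H) : ℂ :=
  inner ℂ (phaseComponent H Ψ) (Matrix.toEuclideanLin (S d).parity (conjPhaseComponent H Ψ))

/-- The expectation of the parity of the outcomes on inputs `x`. -/
noncomputable def parityExpectation (Ψ : JointSpace H A) (S : Strategy H A)
    (x : HonestLabel H) (d : DishonestBits H) : ℝ :=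
  (∑ z, ∑ z', (parityObservable H x z z' : ℂ) *
    inner ℂ (slice Ψ z) (Matrix.toEuclideanLin (S d).parity (slice Ψ z'))).re

theorem sum_neg_one_pow_mul_outcomeProb (Ψ : JointSpace H A) (S : Strategy H A)
    (x : BitString (Fin n)) :
    ∑ y : BitString (Fin n), (-1 : ℝ) ^ hammingWeight y * outcomeProb H Ψ S x y =
      parityExpectation H Ψ S (honestPart H x) (dishonestPart H x) := by
  have h := sum_weighted_inner_rotatedState H (fun h => (-1) ^ hammingWeight h)
    (Matrix.toEuclideanLin (S (dishonestPart H x)).parity) Ψ x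
  simp only [sum_neg_one_pow_conj_honestGates_mul] at h
  rw [parityExpectation, ← h]
  simp only [outcomeProb_eq, hammingWeight_eq_add H, pow_add]
  rw [sum_bitString_eq H fun h d => (-1 : ℝ) ^ hammingWeight h * (-1) ^ hammingWeight d *
    (inner ℂ (slice (rotatedState H Ψ x) h)
        (Matrix.toEuclideanLin ((S (dishonestPart H x)).effect d)
          (slice (rotatedState H Ψ x) h)) : ℂ).re, Complex.re_sum]
  refine Finset.sum_congr rfl fun h _ => ?_
  have hr : ∀ k : ℕ, ((-1 : ℂ) ^ k) = (((-1 : ℝ) ^ k : ℝ) : ℂ) := fun k => by push_cast; rfl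
  simp only [POVM.parity, map_sum, map_smul, LinearMap.sum_apply, LinearMap.smul_apply, inner_sum,
    inner_smul_right, hr, Complex.re_ofReal_mul, Complex.re_sum, Finset.mul_sum, mul_assoc]

theorem sum_outcomeProb (Ψ : JointSpace H A) (S : Strategy H A) (x : BitString (Fin n)) :
    ∑ y : BitString (Fin n), outcomeProb H Ψ S x y = ‖Ψ‖ ^ 2 := by
  simp only [outcomeProb_eq]
  rw [sum_bitString_eq H fun h d => (inner ℂ (slice (rotatedState H Ψ x) h)
        (Matrix.toEuclideanLin ((S (dishonestPart H x)).effect d)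
          (slice (rotatedState H Ψ x) h)) : ℂ).re, ← sum_norm_slice_rotatedState_sq H Ψ x]
  refine Finset.sum_congr rfl fun h _ => ?_
  rw [← Complex.re_sum, ← inner_sum, ← LinearMap.sum_apply, ← map_sum, POVM.sum_effect,
    ← applyOp_eq_toEuclideanLin, applyOp_one, inner_self_eq_norm_sq_to_K]
  norm_cast

/-- The indicator of acceptance is half of one plus the product of the signs of `Δ(y)` and of `Δ(x)
/ 2`. -/
theorem sum_acceptedOutputs (Ψ : JointSpace H A) (S : Strategy H A) (x : BitString (Fin n)) :
    ∑ y ∈ acceptedOutputs x, outcomeProb H Ψ S x y =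
      (‖Ψ‖ ^ 2 + (-1) ^ (hammingWeight x / 2) *
        parityExpectation H Ψ S (honestPart H x) (dishonestPart H x)) / 2 := by
  rw [← sum_neg_one_pow_mul_outcomeProb, ← sum_outcomeProb H Ψ S x, acceptedOutputs,
    Finset.sum_filter, Finset.mul_sum, ← Finset.sum_add_distrib, Finset.sum_div]
  refine Finset.sum_congr rfl fun y _ => ?_
  rcases Nat.even_or_odd (hammingWeight y) with hy | hy <;>
  rcases Nat.even_or_odd (hammingWeight x / 2) with hx | hx <;>
  simp only [hy.neg_one_pow, hx.neg_one_pow]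
  · rw [if_pos (show _ ≡ _ [MOD 2] from (Nat.even_iff.1 hy).trans (Nat.even_iff.1 hx).symm)]
    ring
  · rw [if_neg fun h : _ ≡ _ [MOD 2] => by
      have := Nat.even_iff.1 hy
      have := Nat.odd_iff.1 hx
      have : _ % 2 = _ % 2 := h
      omega]
    ring
  · rw [if_neg fun h : _ ≡ _ [MOD 2] => by
      have := Nat.odd_iff.1 hy
      have := Nat.even_iff.1 hx
      have : _ % 2 = _ % 2 := h
      omega]
    ring
  · rw [if_pos (show _ ≡ _ [MOD 2] from (Nat.odd_iff.1 hy).trans (Nat.odd_iff.1 hx).symm)]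
    ring

theorem correlation_eq_sum (Ψ : JointSpace H A) (S : Strategy H A) (d : DishonestBits H) :
    correlation H Ψ S d = ∑ z, ∑ z', phase z * phase z' *
      inner ℂ (slice Ψ z) (Matrix.toEuclideanLin (S d).parity (slice Ψ z')) := by
  simp only [correlation, phaseComponent, conjPhaseComponent, map_sum, map_smul, sum_inner,
    inner_sum, inner_smul_left, inner_smul_right, Complex.conj_conj, Finset.mul_sum]
  rw [Finset.sum_comm]
  refine Finset.sum_congr rfl fun z _ => Finset.sum_congr rfl fun z' _ => ?_
  ring

theorem conj_correlation_eq_sum (Ψ : JointSpace H A) (S : Strategy H A) (d : DishonestBits H) :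
    starRingEnd ℂ (correlation H Ψ S d) = ∑ z, ∑ z', starRingEnd ℂ (phase z * phase z') *
      inner ℂ (slice Ψ z) (Matrix.toEuclideanLin (S d).parity (slice Ψ z')) := by
  rw [correlation_eq_sum, Finset.sum_comm]
  simp only [map_sum]
  refine Finset.sum_congr rfl fun z _ => Finset.sum_congr rfl fun z' _ => ?_
  rw [map_mul, inner_conj_symm, (S d).parity_isSymmetric, mul_comm (phase z')]

/-- Writing the real part of the weight as half a sum of conjugates, each half collapses by the
rank-one identity `sum_phase_mul_parityObservable`; the conjugate half is the conjugate correlation,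
because the observables have real entries and the parity operator is Hermitian. -/
theorem sum_re_phase_mul_parityExpectation (Ψ : JointSpace H A) (S : Strategy H A)
    (d : DishonestBits H) :
    ∑ x : HonestLabel H, (phase x * phase d).re * parityExpectation H Ψ S x d =
      (phase d * correlation H Ψ S d).re := by
  have hre : ∀ w : ℂ, ((w.re : ℝ) : ℂ) = (w + starRingEnd ℂ w) / 2 := fun w => by
    rw [Complex.add_conj]; simp
  have hcoef : ∀ z z' : HonestLabel H,
      ∑ x : HonestLabel H, (((phase x * phase d).re : ℝ) : ℂ) * (parityObservable H x z z' : ℂ) =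
        (phase d * (phase z * phase z') +
          starRingEnd ℂ (phase d) * starRingEnd ℂ (phase z * phase z')) / 2 := fun z z' => by
    have h1 := sum_phase_mul_parityObservable H z z'
    have h2 := congrArg (starRingEnd ℂ) h1
    simp only [map_sum, map_mul, Complex.conj_ofReal] at h2
    rw [map_mul, ← h1, ← h2, Finset.mul_sum, Finset.mul_sum, ← Finset.sum_add_distrib,
      Finset.sum_div]
    refine Finset.sum_congr rfl fun x _ => ?_
    rw [hre, map_mul]; ring
  have key : ∑ x : HonestLabel H, (((phase x * phase d).re : ℝ) : ℂ) *
      ∑ z, ∑ z', (parityObservable H x z z' : ℂ) *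
        inner ℂ (slice Ψ z) (Matrix.toEuclideanLin (S d).parity (slice Ψ z')) =
      (phase d * correlation H Ψ S d + starRingEnd ℂ (phase d * correlation H Ψ S d)) / 2 := by
    rw [map_mul, conj_correlation_eq_sum, correlation_eq_sum]
    simp only [Finset.mul_sum]
    rw [Finset.sum_comm, ← Finset.sum_add_distrib, Finset.sum_div]
    refine Finset.sum_congr rfl fun z _ => ?_
    rw [Finset.sum_comm, ← Finset.sum_add_distrib, Finset.sum_div]
    refine Finset.sum_congr rfl fun z' _ => ?_
    simp only [← mul_assoc]
    rw [← Finset.sum_mul, hcoef]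
    ring
  rw [← hre] at key
  have := congrArg Complex.re key
  rw [Complex.ofReal_re, Complex.re_sum] at this
  simpa only [parityExpectation, Complex.re_ofReal_mul] using this

theorem two_mul_card_validInputs [Nonempty (Fin n)] :
    (2 : ℝ) * (validInputs n).card = 2 ^ n := by
  have h0 := sum_neg_one_pow_hammingWeight (ι := Fin n) (R := ℝ)
  have h1 : ∑ x : BitString (Fin n), ((1 : ℝ) + (-1) ^ hammingWeight x) = 2 ^ n := by
    rw [Finset.sum_add_distrib, h0]; simp
  rw [← h1, validInputs, Finset.card_filter, Nat.cast_sum, Finset.mul_sum]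
  refine Finset.sum_congr rfl fun x _ => ?_
  rcases Nat.even_or_odd (hammingWeight x) with hx | hx
  · rw [if_pos (Nat.even_iff.1 hx), hx.neg_one_pow]; norm_num
  · rw [if_neg (by rw [Nat.odd_iff.1 hx]; norm_num), hx.neg_one_pow]; norm_num

theorem acceptProb_eq [Nonempty (Fin n)] (Ψ : JointSpace H A) (hΨ : ‖Ψ‖ = 1) (S : Strategy H A) :
    acceptProb H Ψ S = 1 / 2 + (∑ d, (phase d * correlation H Ψ S d).re) / 2 ^ n := by
  have hcard := two_mul_card_validInputs (n := n)
  have hpos : (0 : ℝ) < (validInputs n).card := by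
    have : (0 : ℝ) < 2 ^ n := by positivity
    linarith
  have hsum : ∑ x ∈ validInputs n, (-1 : ℝ) ^ (hammingWeight x / 2) *
      parityExpectation H Ψ S (honestPart H x) (dishonestPart H x) =
      ∑ d, (phase d * correlation H Ψ S d).re := by
    simp only [← sum_re_phase_mul_parityExpectation]
    rw [Finset.sum_comm, ← sum_bitString_eq H fun h d => (phase h * phase d).re *
      parityExpectation H Ψ S h d, validInputs, Finset.sum_filter]
    refine Finset.sum_congr rfl fun x _ => ?_
    rw [← phase_eq_mul, re_phase_eq]
    split_ifs <;> simp
  rw [acceptProb]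
  simp only [sum_acceptedOutputs, hΨ]
  rw [← Finset.sum_div, Finset.sum_add_distrib, hsum, ← hcard]
  simp only [Finset.sum_const, nsmul_eq_mul]
  field_simp

end Acceptance

/-! ### The ideal state and the components of a state along its two honest vectors. -/

section IdealState

variable {n : ℕ} (H : Finset (Fin n)) {A : Type*}

/-- The state `α` together with qubits of the dishonest parties in the (unnormalized) state with
coefficients `w`. -/
noncomputable def dishonestState (w : DishonestBits H → ℂ) (α : EuclideanSpace ℂ A) :
    EuclideanSpace ℂ (DishonestLabel H A) :=
  WithLp.toLp 2 fun q => w q.1 * α q.2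

theorem inner_dishonestState [Fintype A] (w w' : DishonestBits H → ℂ) {α : EuclideanSpace ℂ A}
    (hα : ‖α‖ = 1) :
    (inner ℂ (dishonestState H w α) (dishonestState H w' α) : ℂ) =
      ∑ d, starRingEnd ℂ (w d) * w' d := by
  have h : ∑ s, α s * starRingEnd ℂ (α s) = 1 := by
    have := star_dotProduct_self_of_norm_eq_one hα
    rwa [dotProduct_comm] at this
  simp only [PiLp.inner_apply, dishonestState, Fintype.sum_prod_type, RCLike.inner_apply, map_mul]
  refine Finset.sum_congr rfl fun d _ => ?_
  rw [← mul_one (starRingEnd ℂ (w d) * w' d), ← h, Finset.mul_sum]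
  exact Finset.sum_congr rfl fun s _ => by ring

theorem ghzState_joinBits (h : HonestLabel H) (d : DishonestBits H) :
    ghzState n (joinBits H h d) =
      ((√((2 : ℝ) ^ (n - 1)))⁻¹ : ℂ) * ((phase h * phase d).re : ℝ) := by
  have := phase_eq_mul H (joinBits H h d)
  rw [honestPart_joinBits, dishonestPart_joinBits] at this
  rw [← this, phase, re_I_pow_eq, ghzState]
  simp only [apply_ite Complex.ofReal, Complex.ofReal_one, Complex.ofReal_neg,
    Complex.ofReal_zero]

/-- The amplitudes of the ideal state are real parts of products of an honest and a dishonest phase,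
so it is a sum of two product terms, conjugate in their qubit factors. -/
theorem slice_idealState (α : EuclideanSpace ℂ A) (h : HonestLabel H) :
    slice (idealState H α) h = (((√((2 : ℝ) ^ (n - 1)))⁻¹ / 2 : ℝ) : ℂ) •
      (phase h • dishonestState H phase α +
        starRingEnd ℂ (phase h) • dishonestState H (fun d => starRingEnd ℂ (phase d)) α) := by
  ext ⟨d, s⟩
  have hre : (((phase h * phase d).re : ℝ) : ℂ) =
      (phase h * phase d + starRingEnd ℂ (phase h * phase d)) / 2 := by
    rw [Complex.add_conj]; simp
  simp only [slice, idealState, dishonestState, ghzState_joinBits, hre, map_mul,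
    WithLp.ofLp_smul, WithLp.ofLp_add, Pi.smul_apply, Pi.add_apply, smul_eq_mul]
  push_cast
  ring

theorem inner_idealState_applyDishonest [Fintype A] [DecidableEq A] (α : EuclideanSpace ℂ A)
    (U : Matrix (DishonestLabel H A) (DishonestLabel H A) ℂ) (Ψ : JointSpace H A) :
    (inner ℂ (idealState H α) (applyDishonest H U Ψ) : ℂ) =
      (((√((2 : ℝ) ^ (n - 1)))⁻¹ / 2 : ℝ) : ℂ) *
        (inner ℂ (dishonestState H phase α) (applyOp U (phaseComponent H Ψ)) +
          inner ℂ (dishonestState H (fun d => starRingEnd ℂ (phase d)) α)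
            (applyOp U (conjPhaseComponent H Ψ))) := by
  have hslice : ∀ h, slice (applyDishonest H U Ψ) h = applyOp U (slice Ψ h) := fun h => by
    rw [applyDishonest, slice_applyOp_kronecker]
    simp [Matrix.one_apply]
  rw [inner_eq_sum_inner_slice]
  simp only [hslice, slice_idealState, applyOp_eq_toEuclideanLin, phaseComponent,
    conjPhaseComponent, map_sum, map_smul, inner_sum, inner_add_left, inner_smul_left,
    inner_smul_right, Complex.conj_conj, Complex.conj_ofReal]
  rw [← Finset.sum_add_distrib, Finset.mul_sum]

theorem norm_idealState [Fintype A] [Nonempty (Fin n)] {α : EuclideanSpace ℂ A} (hα : ‖α‖ = 1) :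
    ‖idealState H α‖ = 1 := by
  have hn : 0 < n := Fin.pos_iff_nonempty.2 inferInstance
  have hα2 : ∑ s, ‖α s‖ ^ 2 = 1 := by rw [← EuclideanSpace.norm_sq_eq, hα, one_pow]
  have hcard := two_mul_card_validInputs (n := n)
  have hpow : (2 : ℝ) ^ n = 2 * 2 ^ (n - 1) := by
    rw [← pow_succ', Nat.sub_add_cancel hn]
  have hsum : ∑ h : HonestLabel H, ∑ d : DishonestBits H, (phase h * phase d).re ^ 2
      = 2 ^ (n - 1) := by
    rw [← sum_bitString_eq H fun h d => (phase h * phase d).re ^ 2]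
    have : ((validInputs n).card : ℝ) = 2 ^ (n - 1) := by linarith
    rw [← this, validInputs, Finset.card_filter, Nat.cast_sum]
    refine Finset.sum_congr rfl fun x _ => ?_
    rw [← phase_eq_mul, re_phase_eq]
    split_ifs <;> simp [← pow_mul]
  rw [← sq_eq_sq₀ (norm_nonneg _) zero_le_one, EuclideanSpace.norm_sq_eq, one_pow]
  simp only [Fintype.sum_prod_type, idealState, ghzState_joinBits, norm_mul, mul_pow,
    ← Finset.mul_sum, hα2, mul_one, Complex.norm_real, Real.norm_eq_abs, sq_abs, hsum, norm_inv,
    inv_pow, Real.sq_sqrt (show (0 : ℝ) ≤ 2 ^ (n - 1) by positivity)]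
  exact inv_mul_cancel₀ (by positivity)

theorem norm_applyDishonest [Fintype A] [DecidableEq A] {U : Matrix (DishonestLabel H A) (DishonestLabel H A) ℂ}
    (hU : U ∈ Matrix.unitaryGroup (DishonestLabel H A) ℂ) (Ψ : JointSpace H A) :
    ‖applyDishonest H U Ψ‖ = ‖Ψ‖ :=
  norm_applyOp_of_mem_unitary (Matrix.kronecker_mem_unitary (one_mem _) hU) Ψ

/-- Bessel's inequality for the normalized vectors of phases and of conjugate phases, applied for
each dishonest basis label. They are orthogonal because the signs `(-1)^Δ(h)` sum to zero, which
needs an honest party. -/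
theorem norm_phaseComponent_sq_add_le [Fintype A] [Nonempty {i : Fin n // i ∈ H}] (Ψ : JointSpace H A) :
    ‖phaseComponent H Ψ‖ ^ 2 + ‖conjPhaseComponent H Ψ‖ ^ 2 ≤
      2 ^ Fintype.card {i : Fin n // i ∈ H} * ‖Ψ‖ ^ 2 := by
  set K : ℝ := 2 ^ Fintype.card {i : Fin n // i ∈ H} with hK
  have hK0 : 0 < K := by positivity
  have hsK : √K ≠ 0 := (Real.sqrt_pos.2 hK0).ne'
  let e : EuclideanSpace ℂ (HonestLabel H) := WithLp.toLp 2 fun h => ((√K)⁻¹ : ℝ) * phase h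
  let e' : EuclideanSpace ℂ (HonestLabel H) :=
    WithLp.toLp 2 fun h => ((√K)⁻¹ : ℝ) * starRingEnd ℂ (phase h)
  have hph : ∀ h : HonestLabel H, ‖phase h‖ = 1 := fun h => by simp [phase]
  have hcard : (Fintype.card (HonestLabel H) : ℝ) = K := by
    rw [card_bitString]; push_cast; rfl
  have hnorm : ∀ w : HonestLabel H → ℂ, (∀ h, ‖w h‖ = 1) →
      ‖(WithLp.toLp 2 fun h => ((√K)⁻¹ : ℝ) * w h : EuclideanSpace ℂ (HonestLabel H))‖ = 1 := by
    intro w hw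
    rw [← sq_eq_sq₀ (norm_nonneg _) zero_le_one, EuclideanSpace.norm_sq_eq, one_pow]
    simp only [norm_mul, hw, mul_one, Complex.norm_real, Real.norm_eq_abs, sq_abs, inv_pow,
      Real.sq_sqrt hK0.le, Finset.sum_const, Finset.card_univ, nsmul_eq_mul, hcard]
    exact mul_inv_cancel₀ hK0.ne'
  have horth : (inner ℂ e' e : ℂ) = 0 := by
    have h0 := sum_neg_one_pow_hammingWeight (ι := {i : Fin n // i ∈ H}) (R := ℂ)
    simp only [e, e', PiLp.inner_apply, RCLike.inner_apply, map_mul, Complex.conj_conj,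
      Complex.conj_ofReal]
    have : ∀ h : HonestLabel H, (((√K)⁻¹ : ℝ) : ℂ) * phase h * ((((√K)⁻¹ : ℝ) : ℂ) * phase h)
        = (((√K)⁻¹ : ℝ) : ℂ) * (((√K)⁻¹ : ℝ) : ℂ) * (-1) ^ hammingWeight h := fun h => by
      rw [← phase_sq]; ring
    simp only [this]
    rw [← Finset.mul_sum, h0, mul_zero]
  have hON := orthonormal_pair (hnorm _ fun h => by rw [RCLike.norm_conj, hph])
    (hnorm _ hph) horth
  have hbessel : ∀ q, ‖phaseComponent H Ψ q‖ ^ 2 + ‖conjPhaseComponent H Ψ q‖ ^ 2 ≤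
      K * ∑ h, ‖Ψ (h, q)‖ ^ 2 := by
    intro q
    have h := hON.sum_inner_products_le (s := Finset.univ)
      (WithLp.toLp 2 fun h => Ψ (h, q) : EuclideanSpace ℂ (HonestLabel H))
    rw [Fin.sum_univ_two, EuclideanSpace.norm_sq_eq] at h
    have h1 : (inner ℂ e' (WithLp.toLp 2 fun h => Ψ (h, q) : EuclideanSpace ℂ (HonestLabel H)) : ℂ)
        = ((√K)⁻¹ : ℝ) * conjPhaseComponent H Ψ q := by
      simp only [e', PiLp.inner_apply, RCLike.inner_apply, map_mul, Complex.conj_conj,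
        Complex.conj_ofReal, conjPhaseComponent, slice, WithLp.ofLp_sum, Finset.sum_apply,
        WithLp.ofLp_smul, Pi.smul_apply, smul_eq_mul, Finset.mul_sum]
      exact Finset.sum_congr rfl fun h _ => by ring
    have h2 : (inner ℂ e (WithLp.toLp 2 fun h => Ψ (h, q) : EuclideanSpace ℂ (HonestLabel H)) : ℂ)
        = ((√K)⁻¹ : ℝ) * phaseComponent H Ψ q := by
      simp only [e, PiLp.inner_apply, RCLike.inner_apply, map_mul,
        Complex.conj_ofReal, phaseComponent, slice, WithLp.ofLp_sum, Finset.sum_apply,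
        WithLp.ofLp_smul, Pi.smul_apply, smul_eq_mul, Finset.mul_sum]
      exact Finset.sum_congr rfl fun h _ => by ring
    change ‖(inner ℂ e' _ : ℂ)‖ ^ 2 + ‖(inner ℂ e _ : ℂ)‖ ^ 2 ≤ _ at h
    rw [h1, h2] at h
    simp only [norm_mul, mul_pow, Complex.norm_real, Real.norm_eq_abs, sq_abs, inv_pow,
      Real.sq_sqrt hK0.le] at h
    rw [← mul_add, inv_mul_le_iff₀ hK0] at h
    linarith
  simp only [EuclideanSpace.norm_sq_eq]
  rw [← Finset.sum_add_distrib]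
  refine (Finset.sum_le_sum fun q _ => hbessel q).trans_eq ?_
  rw [← Finset.mul_sum, Finset.sum_comm, Fintype.sum_prod_type]

end IdealState

/-! ### Normalized components and the security bound. -/

section Security

variable {n : ℕ} (H : Finset (Fin n)) {A : Type*} [Fintype A]

/-- The normalized state `phaseComponent`. -/
noncomputable def normalizedPhaseComponent (Ψ : JointSpace H A) :
    EuclideanSpace ℂ (DishonestLabel H A) :=
  (((√((2 : ℝ) ^ Fintype.card {i : Fin n // i ∈ H}))⁻¹ : ℝ) : ℂ) • phaseComponent H Ψ

/-- The normalized state `conjPhaseComponent`. -/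
noncomputable def normalizedConjPhaseComponent (Ψ : JointSpace H A) :
    EuclideanSpace ℂ (DishonestLabel H A) :=
  (((√((2 : ℝ) ^ Fintype.card {i : Fin n // i ∈ H}))⁻¹ : ℝ) : ℂ) • conjPhaseComponent H Ψ

/-- The state of the dishonest parties that is correlated with `phase` in the ideal state. -/
noncomputable def dishonestTarget (w : DishonestBits H → ℂ) (α : EuclideanSpace ℂ A) :
    EuclideanSpace ℂ (DishonestLabel H A) :=
  (((√((2 : ℝ) ^ Fintype.card {i : Fin n // i ∉ H}))⁻¹ : ℝ) : ℂ) • dishonestState H w α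

theorem two_pow_card_mul_two_pow_card :
    (2 : ℝ) ^ Fintype.card {i : Fin n // i ∈ H} * 2 ^ Fintype.card {i : Fin n // i ∉ H} = 2 ^ n := by
  rw [← pow_add]
  congr 1
  have h1 := Fintype.card_subtype_compl (fun i : Fin n => i ∈ H)
  have h2 := Fintype.card_subtype_le (fun i : Fin n => i ∈ H)
  simp only [Fintype.card_fin] at h1 h2
  convert Nat.add_sub_of_le h2

theorem norm_normalizedPhaseComponent_sq_add_le [Nonempty {i : Fin n // i ∈ H}]
    (Ψ : JointSpace H A) :
    ‖normalizedPhaseComponent H Ψ‖ ^ 2 + ‖normalizedConjPhaseComponent H Ψ‖ ^ 2 ≤ ‖Ψ‖ ^ 2 := by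
  have h := norm_phaseComponent_sq_add_le H Ψ
  have hK : (0 : ℝ) < 2 ^ Fintype.card {i : Fin n // i ∈ H} := by positivity
  simp only [normalizedPhaseComponent, normalizedConjPhaseComponent, norm_smul, mul_pow,
    Complex.norm_real, Real.norm_eq_abs, sq_abs, inv_pow, Real.sq_sqrt hK.le]
  rwa [← mul_add, inv_mul_le_iff₀ hK]

theorem acceptProb_eq_add [DecidableEq A] [Nonempty (Fin n)] (Ψ : JointSpace H A) (hΨ : ‖Ψ‖ = 1)
    (S : Strategy H A) :
    acceptProb H Ψ S = 1 / 2 + (∑ d, (phase d * inner ℂ (normalizedPhaseComponent H Ψ)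
      (Matrix.toEuclideanLin (S d).parity (normalizedConjPhaseComponent H Ψ))).re) /
        2 ^ Fintype.card {i : Fin n // i ∉ H} := by
  have hK : (0 : ℝ) < 2 ^ Fintype.card {i : Fin n // i ∈ H} := by positivity
  have hcorr : ∀ d, (phase d * correlation H Ψ S d).re =
      2 ^ Fintype.card {i : Fin n // i ∈ H} * (phase d * inner ℂ (normalizedPhaseComponent H Ψ)
      (Matrix.toEuclideanLin (S d).parity (normalizedConjPhaseComponent H Ψ))).re := fun d => by
    rw [normalizedPhaseComponent, normalizedConjPhaseComponent, map_smul, inner_smul_left,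
      inner_smul_right, Complex.conj_ofReal, ← Complex.re_ofReal_mul, correlation]
    congr 1
    have : (((√((2 : ℝ) ^ Fintype.card {i : Fin n // i ∈ H}))⁻¹ : ℝ) : ℂ) *
        (((√((2 : ℝ) ^ Fintype.card {i : Fin n // i ∈ H}))⁻¹ : ℝ) : ℂ) =
        ((2 ^ Fintype.card {i : Fin n // i ∈ H} : ℝ) : ℂ)⁻¹ := by
      rw [← Complex.ofReal_mul, ← mul_inv, Real.mul_self_sqrt hK.le, Complex.ofReal_inv]
    have hne : ((2 ^ Fintype.card {i : Fin n // i ∈ H} : ℝ) : ℂ) ≠ 0 :=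
      Complex.ofReal_ne_zero.2 hK.ne'
    rw [← mul_assoc (((√((2 : ℝ) ^ Fintype.card {i : Fin n // i ∈ H}))⁻¹ : ℝ) : ℂ), this,
      mul_left_comm (phase d), mul_inv_cancel_left₀ hne]
  rw [acceptProb_eq H Ψ hΨ]
  simp only [hcorr]
  rw [← Finset.mul_sum, ← two_pow_card_mul_two_pow_card H, mul_div_mul_left _ _ hK.ne']

theorem norm_inner_idealState_sq [DecidableEq A] [Nonempty (Fin n)] (α : EuclideanSpace ℂ A)
    (U : Matrix (DishonestLabel H A) (DishonestLabel H A) ℂ) (Ψ : JointSpace H A) :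
    ‖(inner ℂ (idealState H α) (applyDishonest H U Ψ) : ℂ)‖ ^ 2 =
      ‖(inner ℂ (dishonestTarget H phase α) (applyOp U (normalizedPhaseComponent H Ψ)) +
        inner ℂ (dishonestTarget H (fun d => starRingEnd ℂ (phase d)) α)
          (applyOp U (normalizedConjPhaseComponent H Ψ)) : ℂ)‖ ^ 2 / 2 := by
  have hn : 0 < n := Fin.pos_iff_nonempty.2 inferInstance
  have hpow : (2 : ℝ) ^ n = 2 * 2 ^ (n - 1) := by rw [← pow_succ', Nat.sub_add_cancel hn]
  have hKD := two_pow_card_mul_two_pow_card H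
  have hK : (0 : ℝ) < 2 ^ Fintype.card {i : Fin n // i ∈ H} := by positivity
  have hD : (0 : ℝ) < 2 ^ Fintype.card {i : Fin n // i ∉ H} := by positivity
  have hN : (0 : ℝ) < 2 ^ (n - 1) := by positivity
  rw [inner_idealState_applyDishonest]
  simp only [dishonestTarget, normalizedPhaseComponent, normalizedConjPhaseComponent,
    applyOp_eq_toEuclideanLin, map_smul, inner_smul_left, inner_smul_right, Complex.conj_ofReal,
    ← mul_add]
  simp only [norm_mul, mul_pow, Complex.norm_real, Real.norm_eq_abs, sq_abs, inv_pow, div_pow,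
    Real.sq_sqrt hK.le, Real.sq_sqrt hD.le, Real.sq_sqrt hN.le]
  have : ((2 : ℝ) ^ (n - 1))⁻¹ / 2 ^ 2 = (2 ^ Fintype.card {i : Fin n // i ∈ H})⁻¹ *
      ((2 : ℝ) ^ Fintype.card {i : Fin n // i ∉ H})⁻¹ / 2 := by
    rw [← mul_inv, hKD, hpow]; field_simp
  rw [this]; ring

theorem norm_dishonestTarget {w : DishonestBits H → ℂ} (hw : ∀ d, starRingEnd ℂ (w d) * w d = 1)
    {α : EuclideanSpace ℂ A} (hα : ‖α‖ = 1) : ‖dishonestTarget H w α‖ = 1 := by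
  have hD : (0 : ℝ) < 2 ^ Fintype.card {i : Fin n // i ∉ H} := by positivity
  have h := inner_dishonestState H w w hα
  simp only [hw, Finset.sum_const, Finset.card_univ, nsmul_eq_mul, mul_one, card_bitString] at h
  rw [inner_self_eq_norm_sq_to_K] at h
  have h2 : ‖dishonestState H w α‖ ^ 2 = 2 ^ Fintype.card {i : Fin n // i ∉ H} := by
    apply Complex.ofReal_injective
    push_cast at h ⊢
    exact h
  rw [← sq_eq_sq₀ (norm_nonneg _) zero_le_one, dishonestTarget, norm_smul, mul_pow, h2,
    Complex.norm_real, Real.norm_eq_abs, sq_abs, inv_pow, Real.sq_sqrt hD.le,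
    inv_mul_cancel₀ hD.ne', one_pow]

/-- The inner product is a multiple of the sum of `(-1)^Δ(d)`, which vanishes only if there is a
dishonest party; hence the case distinction in the final proof. -/
theorem inner_dishonestTarget_eq_zero [Nonempty {i : Fin n // i ∉ H}]
    {α : EuclideanSpace ℂ A} (hα : ‖α‖ = 1) :
    (inner ℂ (dishonestTarget H (fun d => starRingEnd ℂ (phase d)) α)
      (dishonestTarget H phase α) : ℂ) = 0 := by
  simp only [dishonestTarget, inner_smul_left, inner_smul_right, inner_dishonestState H _ _ hα,
    Complex.conj_conj, phase_sq, sum_neg_one_pow_hammingWeight, mul_zero]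

/-- The minimum exists since the unitary group is compact. The second clause is the form used later:
any single `U` gives an upper bound on `ε²`. -/
theorem exists_isLeast_traceDist [DecidableEq A] [Nonempty (Fin n)] {α : EuclideanSpace ℂ A} (hα : ‖α‖ = 1)
    {Ψ : JointSpace H A} (hΨ : ‖Ψ‖ = 1) :
    ∃ ε : ℝ, IsLeast (Set.range fun U : Matrix.unitaryGroup (DishonestLabel H A) ℂ =>
        traceDist (applyDishonest H (U : Matrix (DishonestLabel H A) (DishonestLabel H A) ℂ) Ψ)
          (idealState H α)) ε ∧
      ∀ U ∈ Matrix.unitaryGroup (DishonestLabel H A) ℂ,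
        ε ^ 2 ≤ 1 - ‖(inner ℂ (idealState H α) (applyDishonest H U Ψ) : ℂ)‖ ^ 2 := by
  have hform : ∀ U : Matrix.unitaryGroup (DishonestLabel H A) ℂ,
      traceDist (applyDishonest H (U : Matrix (DishonestLabel H A) (DishonestLabel H A) ℂ) Ψ)
        (idealState H α) = √(1 - ‖(inner ℂ (idealState H α) (applyDishonest H U Ψ) : ℂ)‖ ^ 2) :=
    fun U => traceDist_eq_sqrt ((norm_applyDishonest H U.2 Ψ).trans hΨ) (norm_idealState H hα)
  have hcont : Continuous fun U : Matrix.unitaryGroup (DishonestLabel H A) ℂ =>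
      √(1 - ‖(inner ℂ (idealState H α) (applyDishonest H U Ψ) : ℂ)‖ ^ 2) := by
    have h : Continuous fun U : Matrix.unitaryGroup (DishonestLabel H A) ℂ =>
        applyDishonest H (U : Matrix (DishonestLabel H A) (DishonestLabel H A) ℂ) Ψ := by
      refine (PiLp.continuous_toLp 2 _).comp (continuous_pi fun i => ?_)
      simp only [Matrix.mulVec, dotProduct, Matrix.kroneckerMap_apply]
      refine continuous_finsetSum _ fun j _ => (continuous_const.mul ?_).mul continuous_const
      exact (continuous_apply_apply i.2 j.2).comp continuous_subtype_val
    fun_prop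
  obtain ⟨U₀, -, hU₀⟩ := isCompact_univ.exists_isMinOn Set.univ_nonempty hcont.continuousOn
  refine ⟨_, ⟨⟨U₀, hform U₀⟩, ?_⟩, fun U hU => ?_⟩
  · rintro _ ⟨U, rfl⟩
    simp only [hform]
    exact hU₀ (Set.mem_univ U)
  · have hle := hU₀ (Set.mem_univ ⟨U, hU⟩)
    have hCS := norm_inner_le_norm (𝕜 := ℂ) (idealState H α) (applyDishonest H U Ψ)
    rw [norm_idealState H hα, norm_applyDishonest H hU, hΨ] at hCS
    rw [← Real.sq_sqrt (show 0 ≤ 1 - ‖(inner ℂ (idealState H α) (applyDishonest H U Ψ) : ℂ)‖ ^ 2 by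
      nlinarith [norm_nonneg (inner ℂ (idealState H α) (applyDishonest H U Ψ) : ℂ)])]
    exact pow_le_pow_left₀ (Real.sqrt_nonneg _) hle 2

theorem re_phase_mul_inner_le {E : Type*} [NormedAddCommGroup E] [InnerProductSpace ℂ E]
    {B : E →ₗ[ℂ] E} (hB : B.IsSymmetric) (hB1 : ∀ x, ‖B x‖ ≤ ‖x‖) (a c : E)
    {ι : Type*} [Fintype ι] (d : BitString ι) :
    (phase d * inner ℂ a (B c)).re ≤
      (1 + (-1) ^ hammingWeight d) / 2 * √((‖a‖ * ‖c‖) ^ 2 - (inner ℂ a c : ℂ).im ^ 2) +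
      (1 - (-1) ^ hammingWeight d) / 2 * √((‖a‖ * ‖c‖) ^ 2 - (inner ℂ a c : ℂ).re ^ 2) := by
  have h1 : |(inner ℂ a (B c) : ℂ).re| ≤ √((‖a‖ * ‖c‖) ^ 2 - (inner ℂ a c : ℂ).im ^ 2) :=
    Real.abs_le_sqrt (by linarith [re_inner_sq_add_im_inner_sq_le hB hB1 a c])
  have h2 : |(inner ℂ a (B c) : ℂ).im| ≤ √((‖a‖ * ‖c‖) ^ 2 - (inner ℂ a c : ℂ).re ^ 2) :=
    Real.abs_le_sqrt (by linarith [im_inner_sq_add_re_inner_sq_le hB hB1 a c])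
  obtain ⟨h1a, h1b⟩ := abs_le.1 h1
  obtain ⟨h2a, h2b⟩ := abs_le.1 h2
  rw [phase]
  rcases Nat.even_or_odd' (hammingWeight d) with ⟨k, hk | hk⟩
  · rw [hk, pow_mul, pow_mul, Complex.I_sq, neg_one_sq, one_pow]
    rcases neg_one_pow_eq_or ℂ k with h | h <;> rw [h] <;> simp <;> linarith
  · rw [hk, pow_succ, pow_succ, pow_mul, pow_mul, Complex.I_sq, neg_one_sq, one_pow]
    rcases neg_one_pow_eq_or ℂ k with h | h <;> rw [h] <;> simp <;> linarith

theorem sum_re_phase_mul_inner_le {E : Type*} [NormedAddCommGroup E] [InnerProductSpace ℂ E]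
    {ι : Type*} [Fintype ι] [DecidableEq ι] [Nonempty ι] {B : BitString ι → E →ₗ[ℂ] E}
    (hB : ∀ d, (B d).IsSymmetric) (hB1 : ∀ d x, ‖B d x‖ ≤ ‖x‖) (a c : E) :
    (∑ d, (phase d * inner ℂ a (B d c)).re) / 2 ^ Fintype.card ι ≤
      (√((‖a‖ * ‖c‖) ^ 2 - (inner ℂ a c : ℂ).im ^ 2) +
        √((‖a‖ * ‖c‖) ^ 2 - (inner ℂ a c : ℂ).re ^ 2)) / 2 := by
  have h0 := sum_neg_one_pow_hammingWeight (ι := ι) (R := ℝ)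
  rw [div_le_iff₀ (by positivity)]
  refine (Finset.sum_le_sum fun d _ => re_phase_mul_inner_le (hB d) (hB1 d) a c d).trans_eq ?_
  -- Each parity class gets total weight `2^(card ι) / 2`, since the signs sum to zero.
  rw [Finset.sum_add_distrib, ← Finset.sum_mul, ← Finset.sum_mul, ← Finset.sum_div,
    ← Finset.sum_div, Finset.sum_add_distrib, Finset.sum_sub_distrib, h0]
  simp only [Finset.sum_const, Finset.card_univ, nsmul_eq_mul, mul_one, card_bitString]
  push_cast
  ring

theorem acceptProb_le_of_nonempty [DecidableEq A] [Nonempty (Fin n)] [Nonempty {i : Fin n // i ∈ H}]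
    [Nonempty {i : Fin n // i ∉ H}] {α : EuclideanSpace ℂ A} (hα : ‖α‖ = 1)
    {Ψ : JointSpace H A} (hΨ : ‖Ψ‖ = 1) {ε : ℝ}
    (hε : ∀ U ∈ Matrix.unitaryGroup (DishonestLabel H A) ℂ,
      ε ^ 2 ≤ 1 - ‖(inner ℂ (idealState H α) (applyDishonest H U Ψ) : ℂ)‖ ^ 2)
    (S : Strategy H A) : acceptProb H Ψ S ≤ 1 - ε ^ 2 / 4 := by
  have hs := norm_normalizedPhaseComponent_sq_add_le H Ψ
  rw [hΨ, one_pow] at hs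
  rw [acceptProb_eq_add H Ψ hΨ S]
  simp only [norm_inner_idealState_sq] at hε
  set a := normalizedPhaseComponent H Ψ
  set c := normalizedConjPhaseComponent H Ψ
  set f := dishonestTarget H phase α
  set f' := dishonestTarget H (fun d => starRingEnd ℂ (phase d)) α
  have hf : ‖f‖ = 1 := norm_dishonestTarget H conj_phase_mul_phase hα
  have hf' : ‖f'‖ = 1 := norm_dishonestTarget H (fun d => by
    rw [Complex.conj_conj, mul_comm, conj_phase_mul_phase]) hα
  have hff' : (inner ℂ f f' : ℂ) = 0 := inner_eq_zero_symm.1 (inner_dishonestTarget_eq_zero H hα)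
  obtain ⟨g, g', hg, hg', hgg', hopt⟩ :=
    exists_orthonormal_pair_inner_add_inner hf hf' hff' a c
  -- Moving the optimal pair onto the targets turns the overlap of `U Ψ` into the optimal value for
  -- `a` and `c`.
  obtain ⟨U, hU, hUg⟩ := exists_mem_unitary_orthonormal (orthonormal_pair hg hg' hgg')
    (orthonormal_pair hf hf' hff')
  have hU1 : applyOp U g = f := hUg 0
  have hU2 : applyOp U g' = f' := hUg 1
  have hεU := hε U hU
  rw [← hU1, ← hU2, inner_applyOp_applyOp_of_mem_unitary hU,
    inner_applyOp_applyOp_of_mem_unitary hU, hopt, Complex.sq_norm, Complex.normSq_apply,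
    ← sq, ← sq] at hεU
  have hsum := sum_re_phase_mul_inner_le (fun d => (S d).parity_isSymmetric)
    (fun d => (S d).norm_parity_le) a c
  have hCS : (inner ℂ a c : ℂ).re ^ 2 + (inner ℂ a c : ℂ).im ^ 2 ≤ (‖a‖ * ‖c‖) ^ 2 := by
    have := pow_le_pow_left₀ (norm_nonneg _) (norm_inner_le_norm (𝕜 := ℂ) a c) 2
    rwa [Complex.sq_norm, Complex.normSq_apply, ← sq, ← sq] at this
  have hreal := sqrt_add_sqrt_le (by positivity) (s := ‖a‖ ^ 2 + ‖c‖ ^ 2)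
    (by nlinarith [sq_nonneg (‖a‖ - ‖c‖)]) hs hCS
  linarith

/-- The two targets coincide, so a unitary taking the direction of `a + c` to `f` gives squared
overlap `‖a + c‖² / 2`, while acceptance is `1/2 + Re ⟨a, c⟩`. The bound follows from `Re ⟨a, c⟩ ≤
(‖a‖² + ‖c‖²) / 2` and `‖a‖² + ‖c‖² ≤ 1`. -/
theorem acceptProb_le_of_isEmpty [DecidableEq A] [Nonempty (Fin n)] [Nonempty {i : Fin n // i ∈ H}]
    [IsEmpty {i : Fin n // i ∉ H}] {α : EuclideanSpace ℂ A} (hα : ‖α‖ = 1)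
    {Ψ : JointSpace H A} (hΨ : ‖Ψ‖ = 1) {ε : ℝ}
    (hε : ∀ U ∈ Matrix.unitaryGroup (DishonestLabel H A) ℂ,
      ε ^ 2 ≤ 1 - ‖(inner ℂ (idealState H α) (applyDishonest H U Ψ) : ℂ)‖ ^ 2)
    (S : Strategy H A) : acceptProb H Ψ S ≤ 1 - ε ^ 2 / 4 := by
  have hs := norm_normalizedPhaseComponent_sq_add_le H Ψ
  rw [hΨ, one_pow] at hs
  rw [acceptProb_eq_add H Ψ hΨ S]
  simp only [norm_inner_idealState_sq] at hε
  set a := normalizedPhaseComponent H Ψ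
  set c := normalizedConjPhaseComponent H Ψ
  set f := dishonestTarget H phase α
  have hphase : ∀ d : DishonestBits H, phase d = 1 := fun d => by simp [phase, hammingWeight]
  have hconj : dishonestTarget H (fun d => starRingEnd ℂ (phase d)) α = f := by
    simp only [f, hphase, map_one, dishonestTarget]
    congr 2
    funext d; rw [hphase]
  have hf : ‖f‖ = 1 := norm_dishonestTarget H conj_phase_mul_phase hα
  obtain ⟨g, hg, hac⟩ := exists_norm_eq_one_smul_norm_eq
    ⟨f, norm_ne_zero_iff.1 (by rw [hf]; exact one_ne_zero)⟩ (a + c)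
  -- The empty string is the only outcome and has weight `0`, so every sign is `1` and the effects
  -- sum to the identity.
  have hpar : ∀ d, (S d).parity = 1 := fun d => by
    rw [POVM.parity, ← (S d).sum_effect]
    refine Finset.sum_congr rfl fun e _ => ?_
    simp [hammingWeight]
  have hon : ∀ {x : EuclideanSpace ℂ (DishonestLabel H A)}, ‖x‖ = 1 → Orthonormal ℂ ![x] :=
    fun {x} hx => by
      rw [orthonormal_iff_ite]
      intro i j
      fin_cases i; fin_cases j
      simp [hx, inner_self_eq_norm_sq_to_K]
  obtain ⟨U, hU, hUg⟩ := exists_mem_unitary_orthonormal (hon hg) (hon hf)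
  have hUg : applyOp U g = f := hUg 0
  have hεU := hε U hU
  have hval : (inner ℂ g a + inner ℂ g c : ℂ) = (‖a + c‖ : ℂ) := by
    rw [← inner_add_right]
    nth_rewrite 1 [hac]
    rw [inner_smul_right, inner_self_eq_norm_sq_to_K, hg]
    simp
  rw [hconj, ← hUg, inner_applyOp_applyOp_of_mem_unitary hU,
    inner_applyOp_applyOp_of_mem_unitary hU, hval, Complex.norm_real, norm_norm,
    norm_add_sq (𝕜 := ℂ)] at hεU
  have hre : RCLike.re (inner ℂ a c : ℂ) ≤ (‖a‖ ^ 2 + ‖c‖ ^ 2) / 2 := by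
    have := (Complex.re_le_norm _).trans (norm_inner_le_norm (𝕜 := ℂ) a c)
    change (inner ℂ a c : ℂ).re ≤ _
    nlinarith [sq_nonneg (‖a‖ - ‖c‖)]
  have hterm : ∀ d, (phase d * inner ℂ a (Matrix.toEuclideanLin (S d).parity c)).re =
      RCLike.re (inner ℂ a c : ℂ) := fun d => by
    rw [hphase, one_mul, hpar, ← applyOp_eq_toEuclideanLin, applyOp_one]
    rfl
  simp only [hterm]
  simp only [Finset.sum_const, Finset.card_univ, card_bitString, Fintype.card_of_isEmpty,
    pow_zero, one_smul, div_one]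
  linarith

end Security

/-- Security of the verification test against a set of colluding dishonest parties: the minimum
`ε` over the unitaries `U` of the dishonest parties of the trace distance between `U Ψ` and the
ideal state exists, and whatever the dishonest parties do, the Verifier `v`, who is honest, accepts
with probability at most `1 - ε ^ 2 / 4`. -/
theorem theorem2 {n : ℕ} (H : Finset (Fin n)) (v : Fin n) (hv : v ∈ H)
    {A : Type*} [Fintype A] [DecidableEq A]
    (α : EuclideanSpace ℂ A) (hα : ‖α‖ = 1)
    (Ψ : JointSpace H A) (hΨ : ‖Ψ‖ = 1) :
    ∃ ε : ℝ,
      IsLeast (Set.range fun U : Matrix.unitaryGroup (DishonestLabel H A) ℂ =>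
        traceDist (applyDishonest H (U : Matrix (DishonestLabel H A) (DishonestLabel H A) ℂ) Ψ)
          (idealState H α)) ε ∧
      ∀ S : Strategy H A, acceptProb H Ψ S ≤ 1 - ε ^ 2 / 4 := by
  have : Nonempty (Fin n) := ⟨v⟩
  have : Nonempty {i : Fin n // i ∈ H} := ⟨⟨v, hv⟩⟩
  obtain ⟨ε, hmin, hε⟩ := exists_isLeast_traceDist H hα hΨ
  refine ⟨ε, hmin, fun S => ?_⟩
  rcases isEmpty_or_nonempty {i : Fin n // i ∉ H} with h | h
  · exact acceptProb_le_of_isEmpty H hα hΨ hε S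
  · exact acceptProb_le_of_nonempty H hα hΨ hε S
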